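/- Call a vertex coloring of a finite graph $G$ a clique coloring if no inclusion-maximal clique of $G$ with at least two vertices is monochromatic, and let the clique chromatic number $\chi_c(G)$ be the smallest number of colors in a clique coloring of $G$. Let $G_{n,p}$ denote the binomial random graph on $n$ vertices, in which each pair of vertices is an edge independently with probability $p$. There is a constant $C \ge e$ such that the following holds for every $\tau \in (0,1)$. Suppose that the integers $k = k(n)$ and the edge-probabilities $p = p(n) \in [0,1]$ satisfy, for all sufficiently large $n$, $k \ge 2$ and the two assumptions $$n^{-1+\tau} \;\le\; p \;\le\; \frac{1}{6C} \cdot \bigl[k^2 \log(1/p)\, n p\bigr]^{-\frac{1}{2(k-1)}} \cdot (1-p^k)^{\frac{n}{k-1}},$$ $$\max\bigl\{np^2,\; p^{-(k-2)/2}\bigr\} \cdot (1-p^k)^{\frac{n(k-2)}{k-1}} \;\ge\; \mathbf{1}_{\{k \ge 3\}}\, k^5 \log(1/p).$$ Then, with probability tending to $1$ as $n \to \infty$, $$\chi_c(G_{n,p}) \;\ge\; \frac{1}{C^2} \cdot \min\left\{\frac{1}{p},\; \frac{p^{k/2}\, n}{\bigl[k!\, k \log(1/p)\bigr]^{1/(k-1)}}\right\}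 \cdot (1-p^k)^{\frac{n}{k-1}}.$$ -/

import Mathlib

namespace CliqueChromatic

/-- A map `c` from the vertices to a set of colors is a clique coloring of `G` if no
inclusion-maximal clique of `G` is monochromatic. Isolated vertices are ignored: only maximal
cliques with at least two vertices are considered. -/
def IsCliqueColoring {V K : Type*} (G : SimpleGraph V) (c : V → K) : Prop :=
  ∀ s : Set V, Maximal G.IsClique s → s.Nontrivial → ¬ ∃ a : K, ∀ v ∈ s, c v = a

/-- The clique chromatic number of a finite graph: the smallest number of colors in a clique
coloring of its vertices. -/
noncomputable def cliqueChromaticNumber {V : Type*} [Finite V] (G : SimpleGraph V) : ℕ :=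
  sInf {m : ℕ | ∃ c : V → Fin m, IsCliqueColoring G c}

/-- The infimum defining the clique chromatic number is over a nonempty set, hence attained. -/
theorem cliqueChromaticNumber_spec {V : Type*} [Finite V] (G : SimpleGraph V) :
    ∃ c : V → Fin (cliqueChromaticNumber G), IsCliqueColoring G c := by
  have h : {m : ℕ | ∃ c : V → Fin m, IsCliqueColoring G c}.Nonempty := by
    refine ⟨Nat.card V, Finite.equivFin V, ?_⟩
    rintro s - ⟨x, hx, y, hy, hxy⟩ ⟨a, ha⟩
    exact hxy ((Finite.equivFin V).injective ((ha x hx).trans (ha y hy).symm))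
  exact Nat.sInf_mem h

end CliqueChromatic

namespace CliqueChromatic

open Finset

/-! ### Expectations over binomial random subsets of a finite set -/

section Expectation

variable {ι κ : Type*}

/-- The expectation of `f B`, where `B` is the random subset of `T` that contains each element
independently with probability `p`. -/
noncomputable def bexp (p : ℝ) (T : Finset ι) (f : Finset ι → ℝ) : ℝ :=
  ∑ B ∈ T.powerset, p ^ #B * (1 - p) ^ (#T - #B) * f B

@[simp] lemma bexp_empty (p : ℝ) (f : Finset ι → ℝ) : bexp p ∅ f = f ∅ := by simp [bexp]

lemma bexp_congr (p : ℝ) {T : Finset ι} {f g : Finset ι → ℝ} (h : ∀ B ⊆ T, f B = g B) :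
    bexp p T f = bexp p T g :=
  sum_congr rfl fun B hB => by rw [h B (mem_powerset.1 hB)]

lemma bexp_mono {p : ℝ} (h0 : 0 ≤ p) (h1 : p ≤ 1) {T : Finset ι} {f g : Finset ι → ℝ}
    (h : ∀ B ⊆ T, f B ≤ g B) : bexp p T f ≤ bexp p T g :=
  sum_le_sum fun B hB => mul_le_mul_of_nonneg_left (h B (mem_powerset.1 hB))
    (mul_nonneg (pow_nonneg h0 _) (pow_nonneg (sub_nonneg.2 h1) _))

lemma bexp_add (p : ℝ) (T : Finset ι) (f g : Finset ι → ℝ) :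
    bexp p T (fun B => f B + g B) = bexp p T f + bexp p T g := by
  simp only [bexp, mul_add, sum_add_distrib]

lemma bexp_sub (p : ℝ) (T : Finset ι) (f g : Finset ι → ℝ) :
    bexp p T (fun B => f B - g B) = bexp p T f - bexp p T g := by
  simp only [bexp, mul_sub, sum_sub_distrib]

lemma bexp_const_mul (p : ℝ) (T : Finset ι) (c : ℝ) (f : Finset ι → ℝ) :
    bexp p T (fun B => c * f B) = c * bexp p T f := by
  simp only [bexp, mul_sum]
  exact sum_congr rfl fun B _ => by ring

lemma bexp_sum (p : ℝ) (T : Finset ι) (s : Finset κ) (f : κ → Finset ι → ℝ) :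
    bexp p T (fun B => ∑ i ∈ s, f i B) = ∑ i ∈ s, bexp p T (f i) := by
  simp only [bexp, mul_sum]
  rw [sum_comm]

lemma bexp_card (p : ℝ) (T : Finset ι) (g : ℕ → ℝ) :
    bexp p T (fun B => g #B) =
      ∑ d ∈ range (#T + 1), (#T).choose d * (p ^ d * (1 - p) ^ (#T - d) * g d) := by
  unfold bexp
  rw [Finset.sum_powerset_apply_card (fun d => p ^ d * (1 - p) ^ (#T - d) * g d)]
  simp

lemma bexp_card_le {p : ℝ} (h0 : 0 ≤ p) (h1 : p ≤ 1) (T : Finset ι) {g : ℕ → ℝ}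
    (hg : ∀ d, 0 ≤ g d) :
    bexp p T (fun B => g #B) ≤ ∑ d ∈ range (#T + 1), (#T).choose d * p ^ d * g d := by
  rw [bexp_card]
  refine sum_le_sum fun d _ => ?_
  have h : (1 - p) ^ (#T - d) ≤ 1 := pow_le_one₀ (sub_nonneg.2 h1) (by linarith)
  calc ((#T).choose d : ℝ) * (p ^ d * (1 - p) ^ (#T - d) * g d)
      = ((#T).choose d * p ^ d * g d) * (1 - p) ^ (#T - d) := by ring
    _ ≤ ((#T).choose d * p ^ d * g d) * 1 :=
        mul_le_mul_of_nonneg_left h (mul_nonneg (by positivity) (hg d))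
    _ = _ := mul_one _

variable [DecidableEq ι]

lemma bexp_insert (p : ℝ) {a : ι} {T : Finset ι} (ha : a ∉ T) (f : Finset ι → ℝ) :
    bexp p (insert a T) f = p * bexp p T (fun B => f (insert a B)) + (1 - p) * bexp p T f := by
  unfold bexp
  rw [Finset.sum_powerset_insert ha, add_comm, mul_sum, mul_sum]
  congr 1
  · refine sum_congr rfl fun B hB => ?_
    have hB' := mem_powerset.1 hB
    rw [card_insert_of_notMem (fun h => ha (hB' h)), card_insert_of_notMem ha,
      Nat.add_sub_add_right, pow_succ]
    ring
  · refine sum_congr rfl fun B hB => ?_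
    have hB' := card_le_card (mem_powerset.1 hB)
    rw [card_insert_of_notMem ha, Nat.succ_sub hB', pow_succ]
    ring

@[simp] lemma bexp_const (p : ℝ) (T : Finset ι) (c : ℝ) : bexp p T (fun _ => c) = c := by
  induction T using Finset.induction_on with
  | empty => simp
  | insert a T ha ih => rw [bexp_insert p ha, ih]; ring

lemma bexp_nonneg {p : ℝ} (h0 : 0 ≤ p) (h1 : p ≤ 1) {T : Finset ι} {f : Finset ι → ℝ}
    (h : ∀ B ⊆ T, 0 ≤ f B) : 0 ≤ bexp p T f := by
  simpa using bexp_mono h0 h1 (f := fun _ => 0) h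

lemma bexp_union (p : ℝ) {T₁ T₂ : Finset ι} (h : Disjoint T₁ T₂) (f : Finset ι → ℝ) :
    bexp p (T₁ ∪ T₂) f = bexp p T₁ (fun B₁ => bexp p T₂ (fun B₂ => f (B₁ ∪ B₂))) := by
  induction T₁ using Finset.induction_on generalizing f with
  | empty => simp
  | insert a T₁ ha ih =>
    rw [disjoint_insert_left] at h
    have ha' : a ∉ T₁ ∪ T₂ := by simp [ha, h.1]
    rw [insert_union, bexp_insert p ha', bexp_insert p ha, ih h.2, ih h.2]
    simp only [insert_union]

lemma bexp_map [DecidableEq κ] (p : ℝ) (e : ι ↪ κ) (T : Finset ι) (f : Finset κ → ℝ) :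
    bexp p (T.map e) f = bexp p T (fun B => f (B.map e)) := by
  induction T using Finset.induction_on generalizing f with
  | empty => simp
  | insert a T ha ih =>
    rw [map_insert, bexp_insert p (by simpa using ha), bexp_insert p ha, ih, ih]
    simp only [map_insert]

lemma bexp_mem (p : ℝ) {T : Finset ι} {a : ι} (ha : a ∈ T) (f : Finset ι → ℝ) :
    bexp p T (fun B => if a ∈ B then f B else 0) = p * bexp p T (fun B => f (insert a B)) := by
  obtain ⟨T, haT, rfl⟩ : ∃ T', a ∉ T' ∧ T = insert a T' :=
    ⟨T.erase a, notMem_erase a T, (insert_erase ha).symm⟩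
  rw [bexp_insert p haT, bexp_insert p haT]
  have h : bexp p T (fun B => if a ∈ B then f B else 0) = bexp p T (fun _ => 0) :=
    bexp_congr p fun B hB => if_neg fun h => haT (hB h)
  simp only [mem_insert_self, if_true, insert_idem, h, bexp_const]
  ring

lemma bexp_subset (p : ℝ) {T F : Finset ι} (hF : F ⊆ T) (f : Finset ι → ℝ) :
    bexp p T (fun B => if F ⊆ B then f B else 0) = p ^ #F * bexp p T (fun B => f (B ∪ F)) := by
  induction F using Finset.induction_on generalizing f with
  | empty => simp
  | insert a F ha ih =>
    rw [insert_subset_iff] at hF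
    have h : ∀ B : Finset ι, (if insert a F ⊆ B then f B else 0) =
        if a ∈ B then (if F ⊆ B then f B else 0) else 0 := fun B => by
      simp only [insert_subset_iff, ite_and]
    simp only [h]
    rw [bexp_mem p hF.1]
    have h2 : ∀ B : Finset ι, (if F ⊆ insert a B then f (insert a B) else 0) =
        if F ⊆ B then f (insert a B) else 0 := fun B => by
      simp only [subset_insert_iff_of_notMem ha]
    simp only [h2]
    rw [ih hF.2 (fun B => f (insert a B)), card_insert_of_notMem ha, pow_succ']
    simp only [union_insert]
    ring

lemma bexp_subset_one (p : ℝ) {T F : Finset ι} (hF : F ⊆ T) :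
    bexp p T (fun B => if F ⊆ B then 1 else 0) = p ^ #F := by
  rw [bexp_subset p hF (fun _ => 1), bexp_const, mul_one]

lemma add_pow_div_factorial_le {x y : ℝ} (hx : 0 ≤ x) (hy : 0 ≤ y) (j : ℕ) :
    x ^ (j + 1) / (j + 1).factorial + y * (x ^ j / j.factorial)
      ≤ (x + y) ^ (j + 1) / (j + 1).factorial := by
  have h : x ^ (j + 1) + (j + 1) * y * x ^ j ≤ (x + y) ^ (j + 1) := by
    induction j with
    | zero => simp
    | succ j ih =>
      have := mul_le_mul_of_nonneg_right ih (add_nonneg hx hy)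
      have h2 : 0 ≤ (j + 1) * y * x ^ j * y := by positivity
      push_cast
      calc _ ≤ (x ^ (j + 1) + (j + 1) * y * x ^ j) * (x + y) := by
            ring_nf; ring_nf at h2; nlinarith [h2]
        _ ≤ _ := this
        _ = _ := by ring
  have hf : ((j + 1).factorial : ℝ) = (j + 1) * j.factorial := by
    rw [Nat.factorial_succ]; push_cast; ring
  have hj : (0 : ℝ) < j.factorial := by positivity
  rw [hf]
  calc _ = (x ^ (j + 1) + (j + 1) * y * x ^ j) / ((j + 1) * j.factorial) := by
        field_simp
    _ ≤ _ := by gcongr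

lemma bexp_choose_le {p : ℝ} (h0 : 0 ≤ p) (T : Finset ι) (b j : ℕ) :
    bexp p T (fun B => ((b + #B).choose j : ℝ)) ≤ (b + #T * p) ^ j / j.factorial := by
  induction T using Finset.induction_on generalizing j with
  | empty => simpa using Nat.choose_le_pow_div (α := ℝ) j b
  | insert a T ha ih =>
    rw [bexp_insert p ha, card_insert_of_notMem ha]
    cases j with
    | zero => simp
    | succ j =>
      have h : bexp p T (fun B => ((b + #(insert a B)).choose (j + 1) : ℝ)) =
          bexp p T (fun B => ((b + #B).choose j : ℝ)) +
          bexp p T (fun B => ((b + #B).choose (j + 1) : ℝ)) := by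
        rw [← bexp_add]
        refine bexp_congr p fun B hB => ?_
        rw [card_insert_of_notMem (fun h => ha (hB h)), ← add_assoc, Nat.choose_succ_succ]
        push_cast; ring
      rw [h]
      have h2 := add_pow_div_factorial_le (x := b + #T * p) (y := p) (by positivity) h0 j
      have h3 := ih j
      have h4 := ih (j + 1)
      have h5 := mul_le_mul_of_nonneg_left h3 h0
      push_cast
      calc _ = p * bexp p T (fun B => ((b + #B).choose j : ℝ))
            + bexp p T (fun B => ((b + #B).choose (j + 1) : ℝ)) := by ring
        _ ≤ (b + #T * p + p) ^ (j + 1) / (j + 1).factorial := by linarith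
        _ = _ := by ring

end Expectation

/-! ### Exponential moments of the number of members of a family inside a random set -/

section Moments

variable {ι : Type*} [DecidableEq ι] {p : ℝ}

lemma exp_le_one_add_add_sq {x : ℝ} (h0 : 0 ≤ x) (h1 : x ≤ 1) : Real.exp x ≤ 1 + x + x ^ 2 := by
  have := abs_le.1 (Real.abs_exp_sub_one_sub_id_le (by rwa [abs_of_nonneg h0] : |x| ≤ 1))
  linarith [this.2]

lemma card_filter_subset_insert_le {U : Finset (Finset ι)} {k : ℕ} (hU : ∀ K ∈ U, #K = k + 1)
    (a : ι) (X : Finset ι) :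
    #{K ∈ U | K ⊆ insert a X} ≤ #{K ∈ U | K ⊆ X} + (#X).choose k := by
  have h : {K ∈ U | K ⊆ insert a X} ⊆
      {K ∈ U | K ⊆ X} ∪ (powersetCard k X).image (insert a) := by
    intro K hK
    simp only [mem_filter] at hK
    by_cases haK : a ∈ K
    · refine mem_union_right _ (mem_image.2 ⟨K.erase a, mem_powersetCard.2 ⟨?_, ?_⟩,
        insert_erase haK⟩)
      · exact (subset_insert_iff).1 hK.2
      · rw [card_erase_of_mem haK, hU K hK.1]; rfl
    · exact mem_union_left _ (mem_filter.2 ⟨hK.1, (subset_insert_iff_of_notMem haK).1 hK.2⟩)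
  calc _ ≤ _ := card_le_card h
    _ ≤ _ := card_union_le _ _
    _ ≤ _ := by
      gcongr
      exact card_image_le.trans (card_powersetCard _ _).le

lemma bexp_exp_card_filter_subset_le (h0 : 0 ≤ p) (h1 : p ≤ 1) {U : Finset (Finset ι)} {k : ℕ}
    (hU : ∀ K ∈ U, #K = k + 1) {θ c D : ℝ} (hθ : 0 ≤ θ) (hθc : θ * c ≤ 1) {T B : Finset ι}
    (hBT : Disjoint B T) (hc : (D + #T * p) ^ k / k.factorial ≤ c) :
    bexp p T (fun N => if (#(B ∪ N) : ℝ) ≤ D then Real.exp (θ * #{K ∈ U | K ⊆ B ∪ N}) else 0) ≤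
      Real.exp (θ * bexp p T (fun N => (#{K ∈ U | K ⊆ B ∪ N} : ℝ)) +
        #T * (p * (θ * c) ^ 2)) := by
  induction T using Finset.induction_on generalizing B with
  | empty =>
    simp only [bexp_empty, union_empty, card_empty, CharP.cast_eq_zero, zero_mul, add_zero]
    split_ifs
    · exact le_rfl
    · positivity
  | insert a T ha ih =>
    rw [disjoint_insert_right] at hBT
    by_cases hBD : (#B : ℝ) ≤ D
    swap
    · have hz : ∀ N : Finset ι, ¬ (#(B ∪ N) : ℝ) ≤ D := fun N h =>
        hBD (le_trans (by exact_mod_cast card_le_card subset_union_left) h)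
      simp only [hz, if_false, bexp_const]
      positivity
    have hD : 0 ≤ D := le_trans (by positivity) hBD
    have hcT : (D + #T * p) ^ k / k.factorial ≤ c := by
      refine le_trans ?_ hc
      rw [card_insert_of_notMem ha]
      push_cast
      gcongr
      linarith
    have hdis : Disjoint (insert a B) T := disjoint_insert_left.2 ⟨ha, hBT.2⟩
    have e1 := ih hdis hcT
    have e0 := ih hBT.2 hcT
    rw [bexp_insert p ha, bexp_insert p ha]
    simp only [union_insert]
    simp only [insert_union] at e1
    set H1 := bexp p T (fun N => (#{K ∈ U | K ⊆ insert a (B ∪ N)} : ℝ)) with hH1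
    set H0 := bexp p T (fun N => (#{K ∈ U | K ⊆ B ∪ N} : ℝ)) with hH0
    have hmono : H0 ≤ H1 := bexp_mono h0 h1 fun N _ => by
      refine Nat.cast_le.2 (card_le_card fun K hK => ?_)
      simp only [mem_filter] at hK ⊢
      exact ⟨hK.1, hK.2.trans (subset_insert _ _)⟩
    have hdiff : H1 ≤ H0 + c := by
      have : H1 ≤ H0 + bexp p T (fun N => ((#B + #N).choose k : ℝ)) := by
        rw [hH0, ← bexp_add]
        refine bexp_mono h0 h1 fun N hN => ?_
        rw [← card_union_of_disjoint (disjoint_of_subset_right hN hBT.2)]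
        exact_mod_cast card_filter_subset_insert_le hU a (B ∪ N)
      have h2 := bexp_choose_le h0 T #B k
      have h3 : ((#B : ℝ) + #T * p) ^ k / k.factorial ≤ (D + #T * p) ^ k / k.factorial := by
        gcongr
      linarith
    have hx0 : 0 ≤ θ * (H1 - H0) := mul_nonneg hθ (by linarith)
    have hxc : θ * (H1 - H0) ≤ θ * c := mul_le_mul_of_nonneg_left (by linarith) hθ
    have hx := exp_le_one_add_add_sq hx0 (hxc.trans hθc)
    have hsq : (θ * (H1 - H0)) ^ 2 ≤ (θ * c) ^ 2 := by gcongr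
    set R := (#T : ℝ) * (p * (θ * c) ^ 2) with hR
    have hE1 : Real.exp (θ * H1 + R) = Real.exp (θ * H0 + R) * Real.exp (θ * (H1 - H0)) := by
      rw [← Real.exp_add]; ring_nf
    have hfin : p * Real.exp (θ * (H1 - H0)) + (1 - p) ≤
        Real.exp (p * (θ * (H1 - H0)) + p * (θ * c) ^ 2) := by
      refine le_trans ?_ (Real.add_one_le_exp _)
      have := mul_le_mul_of_nonneg_left (hx.trans (add_le_add_right hsq _)) h0
      linarith
    calc _ ≤ p * Real.exp (θ * H1 + R) + (1 - p) * Real.exp (θ * H0 + R) :=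
          add_le_add (mul_le_mul_of_nonneg_left e1 h0)
            (mul_le_mul_of_nonneg_left e0 (sub_nonneg.2 h1))
      _ = Real.exp (θ * H0 + R) * (p * Real.exp (θ * (H1 - H0)) + (1 - p)) := by
          rw [hE1]; ring
      _ ≤ Real.exp (θ * H0 + R) * Real.exp (p * (θ * (H1 - H0)) + p * (θ * c) ^ 2) := by
          gcongr
      _ = _ := by
          rw [← Real.exp_add, card_insert_of_notMem ha]
          congr 1
          rw [hR]; push_cast; ring

lemma bexp_card_filter_subset {U : Finset (Finset ι)} {k : ℕ} {S : Finset ι}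
    (hU : U ⊆ powersetCard k S) :
    bexp p S (fun N => (#{K ∈ U | K ⊆ N} : ℝ)) = #U * p ^ k := by
  have h : ∀ N : Finset ι, (#{K ∈ U | K ⊆ N} : ℝ) = ∑ K ∈ U, if K ⊆ N then 1 else 0 := fun N => by
    rw [sum_boole]
  simp only [h]
  rw [bexp_sum, ← nsmul_eq_mul, ← sum_const]
  refine sum_congr rfl fun K hK => ?_
  have := mem_powersetCard.1 (hU hK)
  rw [bexp_subset_one p this.1, this.2]

/-- One step of the exposure of the neighborhoods: `N` is the neighborhood in `S` of a vertex. -/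
lemma bexp_exp_neg_card_filter_not_subset_le (h0 : 0 ≤ p) (h1 : p ≤ 1) {U : Finset (Finset ι)}
    {k : ℕ} {S : Finset ι} (hU : U ⊆ powersetCard (k + 1) S) {θ lam c D M ε : ℝ} (hθ : 0 ≤ θ)
    (hθl : θ ≤ lam) (hlc : lam * c ≤ 1) (hc : (D + #S * p) ^ k / k.factorial ≤ c) (hD : 0 ≤ D)
    (hε : ∑ d ∈ range (#S + 1), (#S).choose d * p ^ d *
      (if D < d ∧ (d : ℝ) ≤ M then Real.exp (lam * d.choose (k + 1)) else 0) ≤ ε) :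
    bexp p S (fun N => if (#N : ℝ) ≤ M then Real.exp (-(θ * #{K ∈ U | ¬ K ⊆ N})) else 0) ≤
      Real.exp (-(θ * (1 - p ^ (k + 1)) * #U) + (#S * (p * (lam * c) ^ 2) + ε)) := by
  have hc0 : 0 ≤ c := le_trans (by positivity) hc
  have hlam : 0 ≤ lam := hθ.trans hθl
  have hlow := bexp_exp_card_filter_subset_le h0 h1
    (fun K hK => (mem_powersetCard.1 (hU hK)).2) hθ
    ((mul_le_mul_of_nonneg_right hθl hc0).trans hlc) (disjoint_empty_left S) hc
  simp only [empty_union] at hlow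
  rw [bexp_card_filter_subset hU] at hlow
  have hhigh := bexp_card_le h0 h1 S
    (g := fun d => if D < d ∧ (d : ℝ) ≤ M then Real.exp (lam * d.choose (k + 1)) else 0)
    (fun d => by positivity)
  have hcount : ∀ N : Finset ι, (#{K ∈ U | ¬ K ⊆ N} : ℝ) = #U - #{K ∈ U | K ⊆ N} := fun N => by
    rw [← card_filter_add_card_filter_not (s := U) (fun K => K ⊆ N)]
    push_cast; ring
  have hpt : ∀ N ⊆ S, (if (#N : ℝ) ≤ M then Real.exp (-(θ * #{K ∈ U | ¬ K ⊆ N})) else 0) ≤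
      Real.exp (-(θ * #U)) * ((if (#N : ℝ) ≤ D then Real.exp (θ * #{K ∈ U | K ⊆ N}) else 0) +
        (if D < #N ∧ (#N : ℝ) ≤ M then Real.exp (lam * (#N).choose (k + 1)) else 0)) := by
    intro N _
    by_cases hM : (#N : ℝ) ≤ M
    swap
    · rw [if_neg hM]; positivity
    have hsplit : Real.exp (-(θ * #{K ∈ U | ¬ K ⊆ N})) =
        Real.exp (-(θ * #U)) * Real.exp (θ * #{K ∈ U | K ⊆ N}) := by
      rw [hcount, ← Real.exp_add]; ring_nf
    rw [if_pos hM, hsplit]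
    refine mul_le_mul_of_nonneg_left ?_ (Real.exp_nonneg _)
    by_cases hND : (#N : ℝ) ≤ D
    · rw [if_pos hND]
      have : 0 ≤ (if D < #N ∧ (#N : ℝ) ≤ M then Real.exp (lam * (#N).choose (k + 1)) else 0) := by
        positivity
      linarith
    · rw [if_neg hND, if_pos ⟨not_le.1 hND, hM⟩, zero_add]
      refine Real.exp_le_exp.2 (mul_le_mul hθl ?_ (by positivity) hlam)
      have : #{K ∈ U | K ⊆ N} ≤ #(powersetCard (k + 1) N) := card_le_card fun K hK => by
        simp only [mem_filter] at hK
        exact mem_powersetCard.2 ⟨hK.2, (mem_powersetCard.1 (hU hK.1)).2⟩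
      rw [card_powersetCard] at this
      exact_mod_cast this
  have hε0 : 0 ≤ ε := le_trans (sum_nonneg fun d _ => by positivity) hε
  have hlow' : Real.exp (θ * (#U * p ^ (k + 1)) + #S * (p * (θ * c) ^ 2)) ≤
      Real.exp (θ * (#U * p ^ (k + 1)) + #S * (p * (lam * c) ^ 2)) := by
    gcongr
  have hA : (1 : ℝ) ≤ Real.exp (θ * (#U * p ^ (k + 1)) + #S * (p * (lam * c) ^ 2)) :=
    Real.one_le_exp (by positivity)
  calc _ ≤ _ := bexp_mono h0 h1 hpt
    _ ≤ Real.exp (-(θ * #U)) * (Real.exp (θ * (#U * p ^ (k + 1)) + #S * (p * (lam * c) ^ 2)) + ε) := by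
        rw [bexp_const_mul, bexp_add]
        gcongr
        · exact hlow.trans hlow'
        · exact hhigh.trans hε
    _ ≤ Real.exp (-(θ * #U)) *
        (Real.exp (θ * (#U * p ^ (k + 1)) + #S * (p * (lam * c) ^ 2)) * Real.exp ε) := by
        gcongr
        nlinarith [Real.add_one_le_exp ε]
    _ = _ := by
        rw [← Real.exp_add, ← Real.exp_add]; ring_nf

end Moments

/-! ### Sets without common neighbors outside a given vertex set -/

section Crossing

variable {V : Type*} [DecidableEq V] {p : ℝ}

/-- The map sending `u` to the pair `{v, u}`. -/
def pairEmb (v : V) : V ↪ Sym2 V := ⟨fun u => s(v, u), fun _ _ h => Sym2.congr_right.1 h⟩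

/-- The pairs with one end in `W` and one end in `S`. -/
def crossing (W S : Finset V) : Finset (Sym2 V) := W.biUnion fun v => S.map (pairEmb v)

/-- The neighbors of `v` in `S` in the graph with edge set `E`. -/
def link (E : Finset (Sym2 V)) (S : Finset V) (v : V) : Finset V := {u ∈ S | s(v, u) ∈ E}

/-- The members of `U` without a common neighbor in `W` in the graph with edge set `E`. -/
def uncovered (U : Finset (Finset V)) (E : Finset (Sym2 V)) (S W : Finset V) :
    Finset (Finset V) :=
  {K ∈ U | ∀ v ∈ W, ¬ K ⊆ link E S v}

lemma mem_uncovered {U : Finset (Finset V)} {E : Finset (Sym2 V)} {S W K : Finset V} :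
    K ∈ uncovered U E S W ↔ K ∈ U ∧ ∀ v ∈ W, ¬ K ⊆ link E S v := mem_filter

lemma mem_crossing {W S : Finset V} {e : Sym2 V} :
    e ∈ crossing W S ↔ ∃ v ∈ W, ∃ u ∈ S, s(v, u) = e := by
  simp only [crossing, mem_biUnion, mem_map]
  rfl

lemma link_union_map_self {W S N : Finset V} {v : V} {E : Finset (Sym2 V)} (hvW : v ∉ W)
    (hvS : v ∉ S) (hE : E ⊆ crossing W S) (hN : N ⊆ S) :
    link (E ∪ N.map (pairEmb v)) S v = N := by
  ext u
  simp only [link, mem_filter, mem_union, mem_map]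
  constructor
  · rintro ⟨-, h | ⟨u', hu', h⟩⟩
    · obtain ⟨w, hw, u', hu', h⟩ := mem_crossing.1 (hE h)
      rcases Sym2.eq_iff.1 h with ⟨rfl, -⟩ | ⟨-, rfl⟩
      · exact absurd hw hvW
      · exact absurd hu' hvS
    · rwa [← (pairEmb v).injective h]
  · intro hu
    exact ⟨hN hu, Or.inr ⟨u, hu, rfl⟩⟩

lemma link_union_map_of_ne {S N : Finset V} {v w : V} {E : Finset (Sym2 V)} (hvw : w ≠ v)
    (hwS : w ∉ S) (hN : N ⊆ S) :
    link (E ∪ N.map (pairEmb v)) S w = link E S w := by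
  ext u
  simp only [link, mem_filter, mem_union, mem_map]
  refine and_congr_right fun _ => ⟨?_, Or.inl⟩
  rintro (h | ⟨u', hu', h⟩)
  · exact h
  · rcases Sym2.eq_iff.1 h with ⟨rfl, -⟩ | ⟨-, rfl⟩
    · exact absurd rfl hvw
    · exact absurd (hN hu') hwS

lemma bexp_crossing_le (h0 : 0 ≤ p) (h1 : p ≤ 1) {U : Finset (Finset V)} {k : ℕ} {S W : Finset V}
    (hWS : Disjoint W S) {lam M β : ℝ}
    (hstep : ∀ U' ⊆ U, ∀ θ, 0 ≤ θ → θ ≤ lam →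
      bexp p S (fun N => if (#N : ℝ) ≤ M then Real.exp (-(θ * #{K ∈ U' | ¬ K ⊆ N})) else 0) ≤
        Real.exp (-(θ * (1 - p ^ k) * #U') + β)) {θ : ℝ} (hθ : 0 ≤ θ) (hθl : θ ≤ lam) :
    bexp p (crossing W S) (fun E => if ∀ v ∈ W, (#(link E S v) : ℝ) ≤ M then
      Real.exp (-(θ * #(uncovered U E S W))) else 0) ≤
      Real.exp (-(θ * (1 - p ^ k) ^ #W * #U) + #W * β) := by
  induction W using Finset.induction_on generalizing θ with
  | empty => simp [crossing, uncovered]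
  | insert v W hvW ih =>
    rw [disjoint_insert_left] at hWS
    have hcr : crossing (insert v W) S = crossing W S ∪ S.map (pairEmb v) := by
      rw [crossing, biUnion_insert, union_comm]; rfl
    have hdis : Disjoint (crossing W S) (S.map (pairEmb v)) := by
      rw [disjoint_left]
      intro e he he'
      obtain ⟨w, hw, u, hu, rfl⟩ := mem_crossing.1 he
      obtain ⟨u', hu', h⟩ := mem_map.1 he'
      rcases Sym2.eq_iff.1 h with ⟨rfl, -⟩ | ⟨rfl, -⟩
      · exact hvW hw
      · exact hWS.1 hu
    rw [hcr, bexp_union p hdis]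
    simp only [bexp_map]
    have hq0 : 0 ≤ 1 - p ^ k := sub_nonneg.2 (pow_le_one₀ h0 h1)
    have hq1 : 1 - p ^ k ≤ 1 := by have := pow_nonneg h0 k; linarith
    have hinner : ∀ E ⊆ crossing W S,
        bexp p S (fun N => if ∀ w ∈ insert v W, (#(link (E ∪ N.map (pairEmb v)) S w) : ℝ) ≤ M then
          Real.exp (-(θ * #(uncovered U (E ∪ N.map (pairEmb v)) S (insert v W)))) else 0) ≤
        Real.exp β * (if ∀ w ∈ W, (#(link E S w) : ℝ) ≤ M then
          Real.exp (-(θ * (1 - p ^ k) * #(uncovered U E S W))) else 0) := by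
      intro E hE
      have hne : ∀ w ∈ W, w ≠ v ∧ w ∉ S := fun w hw =>
        ⟨fun h => hvW (h ▸ hw), disjoint_left.1 hWS.2 hw⟩
      have hdeg : ∀ N ⊆ S, (∀ w ∈ insert v W, (#(link (E ∪ N.map (pairEmb v)) S w) : ℝ) ≤ M) ↔
          (#N : ℝ) ≤ M ∧ ∀ w ∈ W, (#(link E S w) : ℝ) ≤ M := by
        intro N hN
        rw [forall_mem_insert, link_union_map_self hvW hWS.1 hE hN]
        refine and_congr_right fun _ => forall₂_congr fun w hw => ?_
        rw [link_union_map_of_ne (hne w hw).1 (hne w hw).2 hN]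
      have hunc : ∀ N ⊆ S, uncovered U (E ∪ N.map (pairEmb v)) S (insert v W) =
          {K ∈ uncovered U E S W | ¬ K ⊆ N} := by
        intro N hN
        ext K
        simp only [uncovered, mem_filter, forall_mem_insert, and_assoc]
        refine and_congr_right fun _ => ?_
        rw [link_union_map_self hvW hWS.1 hE hN, and_comm]
        refine and_congr_left fun _ => forall₂_congr fun w hw => ?_
        rw [link_union_map_of_ne (hne w hw).1 (hne w hw).2 hN]
      have hcongr := bexp_congr p (T := S)
        (f := fun N => if ∀ w ∈ insert v W, (#(link (E ∪ N.map (pairEmb v)) S w) : ℝ) ≤ M then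
          Real.exp (-(θ * #(uncovered U (E ∪ N.map (pairEmb v)) S (insert v W)))) else 0)
        (g := fun N => if (#N : ℝ) ≤ M ∧ ∀ w ∈ W, (#(link E S w) : ℝ) ≤ M then
          Real.exp (-(θ * #{K ∈ uncovered U E S W | ¬ K ⊆ N})) else 0)
        (fun N hN => by simp only [hdeg N hN, hunc N hN])
      rw [hcongr]
      by_cases hW : ∀ w ∈ W, (#(link E S w) : ℝ) ≤ M
      · rw [if_pos hW]
        simp only [and_iff_left hW]
        refine (hstep _ (filter_subset _ _) θ hθ hθl).trans_eq ?_
        rw [← Real.exp_add, add_comm]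
        rfl
      · rw [if_neg hW]
        simp only [hW, and_false, if_false, bexp_const, mul_zero, le_refl]
    refine (bexp_mono h0 h1 hinner).trans ?_
    rw [bexp_const_mul]
    have h2 := ih hWS.2 (mul_nonneg hθ hq0)
      ((mul_le_of_le_one_right hθ hq1).trans hθl)
    refine (mul_le_mul_of_nonneg_left h2 (Real.exp_nonneg _)).trans_eq ?_
    rw [← Real.exp_add, card_insert_of_notMem hvW, pow_succ]
    congr 1
    push_cast; ring

/-- Lower tail bound for the number of members of `U` without a common neighbor in `W`. -/
lemma bexp_card_uncovered_lt_le (h0 : 0 ≤ p) (h1 : p ≤ 1) {U : Finset (Finset V)} {k : ℕ}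
    {S W : Finset V} (hWS : Disjoint W S) {lam M β t : ℝ} (hlam : 0 ≤ lam)
    (hstep : ∀ U' ⊆ U, ∀ θ, 0 ≤ θ → θ ≤ lam →
      bexp p S (fun N => if (#N : ℝ) ≤ M then Real.exp (-(θ * #{K ∈ U' | ¬ K ⊆ N})) else 0) ≤
        Real.exp (-(θ * (1 - p ^ k) * #U') + β)) :
    bexp p (crossing W S) (fun E => if (∀ v ∈ W, (#(link E S v) : ℝ) ≤ M) ∧
      #(uncovered U E S W) < t then 1 else 0) ≤
      Real.exp (lam * t - lam * (1 - p ^ k) ^ #W * #U + #W * β) := by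
  have h := bexp_crossing_le h0 h1 hWS hstep hlam le_rfl
  calc _ ≤ bexp p (crossing W S) (fun E => Real.exp (lam * t) *
        (if ∀ v ∈ W, (#(link E S v) : ℝ) ≤ M then
          Real.exp (-(lam * #(uncovered U E S W))) else 0)) := by
        refine bexp_mono h0 h1 fun E _ => ?_
        by_cases hM : ∀ v ∈ W, (#(link E S v) : ℝ) ≤ M
        · rw [if_pos hM, ← Real.exp_add]
          split_ifs with hc
          · refine Real.one_le_exp ?_
            have := mul_le_mul_of_nonneg_left hc.2.le hlam
            linarith
          · positivity
        · rw [if_neg (fun hc => hM hc.1), if_neg hM, mul_zero]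
    _ ≤ Real.exp (lam * t) * Real.exp (-(lam * (1 - p ^ k) ^ #W * #U) + #W * β) := by
        rw [bexp_const_mul]
        gcongr
    _ = _ := by rw [← Real.exp_add]; ring_nf

end Crossing

/-! ### Janson's inequality -/

section Janson

variable {ι κ : Type*} {p : ℝ}

lemma one_sub_sum_le_prod_one_sub [DecidableEq κ] {s : Finset κ} {x : κ → ℝ} (h0 : ∀ i ∈ s, 0 ≤ x i)
    (h1 : ∀ i ∈ s, x i ≤ 1) : 1 - ∑ i ∈ s, x i ≤ ∏ i ∈ s, (1 - x i) := by
  induction s using Finset.induction_on with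
  | empty => simp
  | insert a s ha ih =>
    rw [sum_insert ha, prod_insert ha]
    have e := ih (fun i hi => h0 i (mem_insert_of_mem hi)) fun i hi => h1 i (mem_insert_of_mem hi)
    have ha0 := h0 a (mem_insert_self _ _)
    have ha1 := h1 a (mem_insert_self _ _)
    have hp : ∏ i ∈ s, (1 - x i) ≤ 1 := prod_le_one
      (fun i hi => sub_nonneg.2 (h1 i (mem_insert_of_mem hi)))
      (fun i hi => by linarith [h0 i (mem_insert_of_mem hi)])
    nlinarith [mul_nonneg ha0 (sub_nonneg.2 hp)]

variable [DecidableEq ι]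

/-- The events that the random set contains `F i`, each thinned with probability `q`:
the probability that none of the events in `s` happens, given the random set `B`. -/
noncomputable def avoid (q : ℝ) (F : κ → Finset ι) (s : Finset κ) (B : Finset ι) : ℝ :=
  ∏ i ∈ s, (1 - q * (if F i ⊆ B then 1 else 0))

variable {q : ℝ} {F : κ → Finset ι}

lemma avoid_factor_mem (hq0 : 0 ≤ q) (hq1 : q ≤ 1) (i : κ) (B : Finset ι) :
    0 ≤ 1 - q * (if F i ⊆ B then 1 else 0) ∧ 1 - q * (if F i ⊆ B then (1 : ℝ) else 0) ≤ 1 := by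
  split_ifs <;> constructor <;> linarith

lemma avoid_nonneg (hq0 : 0 ≤ q) (hq1 : q ≤ 1) (s : Finset κ) (B : Finset ι) :
    0 ≤ avoid q F s B := prod_nonneg fun i _ => (avoid_factor_mem hq0 hq1 i B).1

lemma avoid_anti (hq0 : 0 ≤ q) (hq1 : q ≤ 1) (s : Finset κ) {A B : Finset ι} (h : A ⊆ B) :
    avoid q F s B ≤ avoid q F s A := by
  refine prod_le_prod (fun i _ => (avoid_factor_mem hq0 hq1 i B).1) fun i _ => ?_
  by_cases hA : F i ⊆ A
  · rw [if_pos hA, if_pos (hA.trans h)]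
  · rw [if_neg hA]
    have := (avoid_factor_mem (F := F) hq0 hq1 i B).2
    linarith

variable [DecidableEq κ]

/-- **Janson's inequality**, in its thinned form. -/
lemma bexp_avoid_le (h0 : 0 ≤ p) (h1 : p ≤ 1) (hq0 : 0 ≤ q) (hq1 : q ≤ 1) {T : Finset ι}
    {s : Finset κ} (hF : ∀ i ∈ s, F i ⊆ T) :
    bexp p T (avoid q F s) ≤ Real.exp (-(q * ∑ i ∈ s, p ^ #(F i)) +
      q ^ 2 * ∑ i ∈ s, ∑ j ∈ s with j ≠ i ∧ ¬ Disjoint (F i) (F j), p ^ #(F i ∪ F j)) := by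
  induction s using Finset.induction_on with
  | empty =>
    have h : avoid q F (∅ : Finset κ) = fun _ => 1 := by funext B; simp [avoid]
    simp [h]
  | insert a s ha ih =>
    have hFs : ∀ i ∈ s, F i ⊆ T := fun i hi => hF i (mem_insert_of_mem hi)
    have hFa : F a ⊆ T := hF a (mem_insert_self _ _)
    set N := {j ∈ s | ¬ Disjoint (F a) (F j)} with hN
    set N' := {j ∈ s | Disjoint (F a) (F j)} with hN'
    have hsplit : ∀ B, avoid q F s B = avoid q F N' B * avoid q F N B := fun B =>
      (prod_filter_mul_prod_filter_not s (fun j => Disjoint (F a) (F j)) _).symm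
    set Z := bexp p T (avoid q F N') with hZ
    set Y := bexp p T (avoid q F s) with hY
    have hYZ : Y ≤ Z := bexp_mono h0 h1 fun B _ => by
      rw [hsplit]
      exact mul_le_of_le_one_right (avoid_nonneg hq0 hq1 _ _)
        (prod_le_one (fun i _ => (avoid_factor_mem hq0 hq1 i B).1)
          fun i _ => (avoid_factor_mem hq0 hq1 i B).2)
    have hY0 : 0 ≤ Y := bexp_nonneg h0 h1 fun B _ => avoid_nonneg hq0 hq1 _ _
    have hZ0 : 0 ≤ Z := hY0.trans hYZ
    have hind : bexp p T (fun B => if F a ⊆ B then avoid q F N' B else 0) = p ^ #(F a) * Z := by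
      rw [bexp_subset p hFa]
      congr 1
      refine bexp_congr p fun B _ => prod_congr rfl fun j hj => ?_
      have hd := (mem_filter.1 hj).2
      have : F j ⊆ B ∪ F a ↔ F j ⊆ B :=
        ⟨fun h x hx => (mem_union.1 (h hx)).resolve_right fun hxa =>
          disjoint_left.1 hd hxa hx, fun h => h.trans subset_union_left⟩
      simp only [this]
    have hneg : ∀ j ∈ s, bexp p T (fun B => if F a ∪ F j ⊆ B then avoid q F N' B else 0) ≤
        p ^ #(F a ∪ F j) * Z := by
      intro j hj
      rw [bexp_subset p (union_subset hFa (hFs j hj))]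
      exact mul_le_mul_of_nonneg_left
        (bexp_mono h0 h1 fun B _ => avoid_anti hq0 hq1 _ subset_union_left) (pow_nonneg h0 _)
    set x := p ^ #(F a) - q * ∑ j ∈ N, p ^ #(F a ∪ F j) with hx
    have hlow : x * Z ≤ bexp p T (fun B => if F a ⊆ B then avoid q F s B else 0) := by
      calc x * Z = p ^ #(F a) * Z - q * ∑ j ∈ N, p ^ #(F a ∪ F j) * Z := by
            rw [hx, sub_mul, mul_assoc, sum_mul]
        _ ≤ bexp p T (fun B => if F a ⊆ B then avoid q F N' B else 0) -
            q * ∑ j ∈ N, bexp p T (fun B => if F a ∪ F j ⊆ B then avoid q F N' B else 0) := by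
            rw [hind]
            gcongr with j hj
            exact hneg j (mem_filter.1 hj).1
        _ = bexp p T (fun B => (if F a ⊆ B then avoid q F N' B else 0) -
            q * ∑ j ∈ N, if F a ∪ F j ⊆ B then avoid q F N' B else 0) := by
            rw [bexp_sub, bexp_const_mul, bexp_sum]
        _ ≤ _ := bexp_mono h0 h1 fun B _ => by
            by_cases hB : F a ⊆ B
            · simp only [union_subset_iff, hB, true_and, if_true]
              have h := one_sub_sum_le_prod_one_sub (s := N)
                (x := fun j => q * (if F j ⊆ B then (1 : ℝ) else 0))
                (fun i _ => by positivity) (fun i _ => by split_ifs <;> linarith)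
              have h2 := mul_le_mul_of_nonneg_left h (avoid_nonneg (F := F) hq0 hq1 N' B)
              rw [hsplit]
              refine le_trans (le_of_eq ?_) h2
              rw [mul_sub, mul_one, mul_sum, mul_sum]
              congr 1
              exact sum_congr rfl fun j _ => by split_ifs <;> ring
            · simp [union_subset_iff, hB]
    have hxY : x * Y ≤ bexp p T (fun B => if F a ⊆ B then avoid q F s B else 0) := by
      rcases le_total 0 x with hx0 | hx0
      · exact (mul_le_mul_of_nonneg_left hYZ hx0).trans hlow
      · exact (mul_nonpos_of_nonpos_of_nonneg hx0 hY0).trans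
          (bexp_nonneg h0 h1 fun B _ => by
            split_ifs
            · exact avoid_nonneg hq0 hq1 _ _
            · exact le_rfl)
    have hstep : bexp p T (avoid q F (insert a s)) =
        Y - q * bexp p T (fun B => if F a ⊆ B then avoid q F s B else 0) := by
      rw [hY, ← bexp_const_mul, ← bexp_sub]
      refine bexp_congr p fun B _ => ?_
      rw [avoid, prod_insert ha, ← avoid]
      split_ifs <;> ring
    have hle : bexp p T (avoid q F (insert a s)) ≤ Real.exp (-(q * x)) * Y := by
      rw [hstep]
      have := mul_le_mul_of_nonneg_left hxY hq0
      have h2 := mul_le_mul_of_nonneg_right (Real.add_one_le_exp (-(q * x))) hY0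
      linarith
    refine hle.trans ((mul_le_mul_of_nonneg_left (ih hFs) (Real.exp_nonneg _)).trans ?_)
    rw [← Real.exp_add]
    refine Real.exp_le_exp.2 ?_
    have hsum : ∑ j ∈ N, p ^ #(F a ∪ F j) +
        ∑ i ∈ s, ∑ j ∈ s with j ≠ i ∧ ¬ Disjoint (F i) (F j), p ^ #(F i ∪ F j) ≤
        ∑ i ∈ insert a s, ∑ j ∈ insert a s with j ≠ i ∧ ¬ Disjoint (F i) (F j),
          p ^ #(F i ∪ F j) := by
      rw [sum_insert ha]
      refine add_le_add ?_ (sum_le_sum fun i hi => ?_)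
      · refine sum_le_sum_of_subset_of_nonneg (fun j hj => ?_) fun j _ _ => pow_nonneg h0 _
        simp only [hN, mem_filter] at hj
        exact mem_filter.2 ⟨mem_insert_of_mem hj.1, fun h => ha (h ▸ hj.1), hj.2⟩
      · refine sum_le_sum_of_subset_of_nonneg (fun j hj => ?_) fun j _ _ => pow_nonneg h0 _
        simp only [mem_filter] at hj ⊢
        exact ⟨mem_insert_of_mem hj.1, hj.2⟩
    have := mul_le_mul_of_nonneg_left hsum (sq_nonneg q)
    rw [sum_insert ha]
    rw [hx]
    linarith

/-- Janson's inequality for the event that the random set contains no `F i`. -/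
lemma bexp_forall_not_subset_le (h0 : 0 ≤ p) (h1 : p ≤ 1) (hq0 : 0 ≤ q) (hq1 : q ≤ 1)
    {T : Finset ι} {s : Finset κ} (hF : ∀ i ∈ s, F i ⊆ T) :
    bexp p T (fun B => if ∀ i ∈ s, ¬ F i ⊆ B then 1 else 0) ≤
      Real.exp (-(q * ∑ i ∈ s, p ^ #(F i)) +
      q ^ 2 * ∑ i ∈ s, ∑ j ∈ s with j ≠ i ∧ ¬ Disjoint (F i) (F j), p ^ #(F i ∪ F j)) := by
  refine le_trans (bexp_mono h0 h1 fun B _ => ?_) (bexp_avoid_le h0 h1 hq0 hq1 hF)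
  split_ifs with h
  · refine (prod_eq_one fun i hi => ?_).ge
    rw [if_neg (h i hi)]; ring
  · exact avoid_nonneg hq0 hq1 _ _

end Janson

/-! ### Cliques in random graphs -/

section Cliques

variable {V : Type*} [DecidableEq V] {p : ℝ}

/-- The pairs of distinct elements of `K`. -/
def pairs (K : Finset V) : Finset (Sym2 V) := {e ∈ K.sym2 | ¬ e.IsDiag}

lemma mem_pairs {K : Finset V} {u v : V} : s(u, v) ∈ pairs K ↔ u ∈ K ∧ v ∈ K ∧ u ≠ v := by
  simp [pairs, and_assoc]

lemma pairs_mono {K L : Finset V} (h : K ⊆ L) : pairs K ⊆ pairs L := by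
  intro e
  induction e with
  | h u v =>
    simp only [mem_pairs]
    exact fun ⟨a, b, c⟩ => ⟨h a, h b, c⟩

lemma pairs_inter (K L : Finset V) : pairs (K ∩ L) = pairs K ∩ pairs L := by
  ext e
  induction e with
  | h u v =>
    simp only [mem_pairs, mem_inter]
    tauto

lemma card_pairs (K : Finset V) : #(pairs K) = (#K).choose 2 := by
  have h := card_filter_add_card_filter_not (s := K.sym2) (fun e => e.IsDiag)
  have h2 : #{e ∈ K.sym2 | e.IsDiag} = #K := by
    have : {e ∈ K.sym2 | e.IsDiag} = K.image Sym2.diag := by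
      ext e
      induction e with
      | h u v =>
        simp only [mem_filter, mk_mem_sym2_iff, Sym2.mk_isDiag_iff, mem_image, Sym2.diag]
        constructor
        · rintro ⟨⟨h1, -⟩, rfl⟩
          exact ⟨u, h1, rfl⟩
        · rintro ⟨w, hw, h⟩
          rcases Sym2.eq_iff.1 h with ⟨rfl, rfl⟩ | ⟨rfl, rfl⟩ <;> exact ⟨⟨hw, hw⟩, rfl⟩
    rw [this, card_image_of_injective _ Sym2.diag_injective]
  rw [h2, card_sym2] at h
  have h3 : (#K + 1).choose 2 = #K + (#K).choose 2 := by
    rw [Nat.choose_succ_succ' (#K) 1, Nat.choose_one_right]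
  unfold pairs
  omega

lemma card_filter_inter_eq_le (K J S : Finset V) (k : ℕ) (U : Finset (Finset V))
    (hU : U ⊆ powersetCard k S) :
    #{L ∈ U | K ∩ L = J} ≤ (#S).choose (k - #J) := by
  rw [← card_powersetCard]
  refine card_le_card_of_injOn (fun L => L \ J) ?_ ?_
  · intro L hL
    simp only [coe_filter, Set.mem_ofPred_eq] at hL
    have h := mem_powersetCard.1 (hU hL.1)
    have hJ : J ⊆ L := hL.2 ▸ inter_subset_right
    exact mem_coe.2 (mem_powersetCard.2 ⟨sdiff_subset.trans h.1, by
      rw [card_sdiff_of_subset hJ, h.2]⟩)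
  · intro L hL L' hL' h
    simp only [coe_filter, Set.mem_ofPred_eq] at hL hL'
    have hJ : J ⊆ L := hL.2 ▸ inter_subset_right
    have hJ' : J ⊆ L' := hL'.2 ▸ inter_subset_right
    rw [← sdiff_union_of_subset hJ, ← sdiff_union_of_subset hJ']
    simp only at h
    rw [h]

/-- An upper bound for the expected number of cliques of size `k` in `G(s, p)` that share at
least two vertices with, and are different from, a given clique of size `k`. -/
noncomputable def overlap (p : ℝ) (s k : ℕ) : ℝ :=
  ∑ j ∈ Ico 2 k, k.choose j * ((s : ℝ) ^ (k - j) / (k - j).factorial *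
    p ^ (k.choose 2 - j.choose 2))

lemma sum_pow_pairs_le (h0 : 0 ≤ p) {k : ℕ} {S : Finset V} {U : Finset (Finset V)}
    (hU : U ⊆ powersetCard k S) {K : Finset V} (hK : K ∈ U) :
    ∑ L ∈ U with L ≠ K ∧ ¬ Disjoint (pairs K) (pairs L), p ^ #(pairs K ∪ pairs L) ≤
      p ^ k.choose 2 * overlap p #S k := by
  have hcard : ∀ L ∈ U, #L = k := fun L hL => (mem_powersetCard.1 (hU hL)).2
  set A := {L ∈ U | L ≠ K ∧ ¬ Disjoint (pairs K) (pairs L)} with hA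
  set J := {J ∈ K.powerset | #J ∈ Ico 2 k} with hJ
  have hmaps : ∀ L ∈ A, K ∩ L ∈ J := by
    intro L hL
    simp only [hA, mem_filter] at hL
    refine mem_filter.2 ⟨mem_powerset.2 inter_subset_left, mem_Ico.2 ⟨?_, ?_⟩⟩
    · by_contra hlt
      refine hL.2.2 (disjoint_iff_inter_eq_empty.2 ?_)
      rw [← pairs_inter, ← card_eq_zero, card_pairs]
      exact Nat.choose_eq_zero_of_lt (not_le.1 hlt)
    · refine lt_of_le_of_ne ((card_le_card inter_subset_left).trans (hcard K hK).le) fun h => ?_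
      have h1 : K ∩ L = K := eq_of_subset_of_card_le inter_subset_left (by rw [h, hcard K hK])
      have h2 : K ⊆ L := inter_eq_left.1 h1
      exact hL.2.1 (eq_of_subset_of_card_le h2 (by rw [hcard K hK, hcard L hL.1])).symm
  have hterm : ∀ L ∈ A, p ^ #(pairs K ∪ pairs L) =
      p ^ k.choose 2 * p ^ (k.choose 2 - (#(K ∩ L)).choose 2) := by
    intro L hL
    have hLU := (mem_filter.1 hL).1
    have h := card_union_add_card_inter (pairs K) (pairs L)
    rw [← pairs_inter, card_pairs, card_pairs, card_pairs, hcard K hK, hcard L hLU] at h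
    have h2 : (#(K ∩ L)).choose 2 ≤ k.choose 2 :=
      Nat.choose_le_choose 2 ((card_le_card inter_subset_left).trans (hcard K hK).le)
    rw [← pow_add]
    congr 1
    omega
  rw [sum_congr rfl hterm, ← mul_sum]
  refine mul_le_mul_of_nonneg_left ?_ (pow_nonneg h0 _)
  rw [← sum_fiberwise_of_maps_to hmaps]
  have hfib : ∀ I ∈ J, ∑ L ∈ A with K ∩ L = I, p ^ (k.choose 2 - (#(K ∩ L)).choose 2) ≤
      (#S : ℝ) ^ (k - #I) / (k - #I).factorial * p ^ (k.choose 2 - (#I).choose 2) := by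
    intro I _
    have e : ∀ L ∈ {L ∈ A | K ∩ L = I}, p ^ (k.choose 2 - (#(K ∩ L)).choose 2) =
        p ^ (k.choose 2 - (#I).choose 2) := fun L hL => by rw [(mem_filter.1 hL).2]
    rw [sum_congr rfl e, sum_const, nsmul_eq_mul]
    refine mul_le_mul_of_nonneg_right ?_ (pow_nonneg h0 _)
    have h1 : #{L ∈ A | K ∩ L = I} ≤ (#S).choose (k - #I) :=
      card_filter_inter_eq_le K I S k A ((filter_subset _ _).trans hU)
    exact (Nat.cast_le.2 h1).trans (Nat.choose_le_pow_div _ _)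
  refine (sum_le_sum hfib).trans (le_of_eq ?_)
  rw [hJ, sum_filter, sum_powerset_apply_card (fun j => if j ∈ Ico 2 k then
    (#S : ℝ) ^ (k - j) / (k - j).factorial * p ^ (k.choose 2 - j.choose 2) else 0), hcard K hK,
    overlap]
  simp only [smul_ite, smul_zero, nsmul_eq_mul]
  rw [← sum_filter]
  refine sum_congr ?_ fun _ _ => rfl
  ext j
  simp only [mem_filter, mem_range, mem_Ico]
  omega

/-- The probability that no member of `U` is a clique. -/
lemma bexp_no_clique_le (h0 : 0 ≤ p) (h1 : p ≤ 1) {k : ℕ} {S : Finset V} {U : Finset (Finset V)}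
    (hU : U ⊆ powersetCard k S) {q : ℝ} (hq0 : 0 ≤ q) (hq1 : q ≤ 1)
    (hq : q * overlap p #S k ≤ 1 / 2) :
    bexp p (pairs S) (fun B => if ∀ K ∈ U, ¬ pairs K ⊆ B then 1 else 0) ≤
      Real.exp (-(q / 2 * (#U * p ^ k.choose 2))) := by
  have hcard : ∀ L ∈ U, #L = k := fun L hL => (mem_powersetCard.1 (hU hL)).2
  refine (bexp_forall_not_subset_le h0 h1 hq0 hq1 fun K hK =>
    pairs_mono (mem_powersetCard.1 (hU hK)).1).trans (Real.exp_le_exp.2 ?_)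
  have e1 : ∑ K ∈ U, p ^ #(pairs K) = #U * p ^ k.choose 2 := by
    rw [← nsmul_eq_mul, ← sum_const]
    exact sum_congr rfl fun K hK => by rw [card_pairs, hcard K hK]
  have e2 := sum_le_sum fun K hK => sum_pow_pairs_le h0 hU (K := K) hK
  rw [sum_const, nsmul_eq_mul] at e2
  rw [e1]
  have h3 := mul_le_mul_of_nonneg_left e2 (sq_nonneg q)
  have h4 := mul_le_mul_of_nonneg_right hq
    (mul_nonneg hq0 (mul_nonneg (Nat.cast_nonneg #U) (pow_nonneg h0 (k.choose 2))))
  nlinarith [h3, h4]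

end Cliques

/-! ### Sets without maximal cliques -/

section BadSets

variable {V : Type*} [DecidableEq V]

lemma disjoint_crossing_pairs {W S : Finset V} (h : Disjoint W S) {A : Finset V}
    (hA : A = S ∨ A = W) : Disjoint (crossing W S) (pairs A) := by
  rw [disjoint_left]
  intro e he he'
  obtain ⟨w, hw, u, hu, rfl⟩ := mem_crossing.1 he
  have := mem_pairs.1 he'
  rcases hA with rfl | rfl
  · exact disjoint_left.1 h hw this.1
  · exact disjoint_left.1 h this.2.1 hu

lemma disjoint_pairs {W S : Finset V} (h : Disjoint W S) : Disjoint (pairs W) (pairs S) := by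
  rw [disjoint_iff_inter_eq_empty, ← pairs_inter, disjoint_iff_inter_eq_empty.1 h]
  rfl

variable [Fintype V] {p : ℝ}

/-- In the graph with edge set `E`, the vertices outside `S` have at most `M` neighbors in `S`,
and every clique of size `k` inside `S` has a common neighbor outside `S`. -/
def Covered (E : Finset (Sym2 V)) (k : ℕ) (M : ℝ) (S : Finset V) : Prop :=
  (∀ v ∈ Sᶜ, (#(link E S v) : ℝ) ≤ M) ∧
    ∀ K ∈ powersetCard k S, pairs K ⊆ E → ∃ v ∈ Sᶜ, K ⊆ link E S v

noncomputable instance (E : Finset (Sym2 V)) (k : ℕ) (M : ℝ) (S : Finset V) :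
    Decidable (Covered E k M S) := Classical.propDecidable _

lemma exists_covered_of_isCliqueColoring {E : Finset (Sym2 V)} {k s m : ℕ} {M : ℝ} (hk : 2 ≤ k)
    (hM : ∀ v, (#(link E univ v) : ℝ) ≤ M) {c : V → Fin m}
    (hc : IsCliqueColoring (SimpleGraph.fromEdgeSet (E : Set (Sym2 V))) c)
    (hs : m * (s - 1) < Fintype.card V) :
    ∃ S ∈ powersetCard s (univ : Finset V), Covered E k M S := by
  obtain ⟨a, -, ha⟩ := exists_lt_card_fiber_of_mul_lt_card_of_maps_to
    (s := (univ : Finset V)) (t := (univ : Finset (Fin m))) (f := c) (n := s - 1)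
    (fun _ _ => mem_univ _) (by simpa using hs)
  obtain ⟨S, hSa, hS⟩ := exists_subset_card_eq (s := {x ∈ univ | c x = a}) (n := s) (by omega)
  refine ⟨S, mem_powersetCard.2 ⟨subset_univ _, hS⟩, fun v _ => ?_, fun K hK hKE => ?_⟩
  · refine le_trans (Nat.cast_le.2 (card_le_card ?_)) (hM v)
    exact filter_subset_filter _ (subset_univ _)
  by_contra hcon
  push Not at hcon
  have hKS := (mem_powersetCard.1 hK).1
  set G := SimpleGraph.fromEdgeSet (E : Set (Sym2 V)) with hG
  have hKG : G.IsClique (K : Set V) := by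
    intro u hu v hv huv
    rw [hG, SimpleGraph.fromEdgeSet_adj]
    exact ⟨hKE (mem_pairs.2 ⟨hu, hv, huv⟩), huv⟩
  have hfin : {Q : Set V | Q ⊆ S ∧ G.IsClique Q}.Finite := Set.toFinite _
  obtain ⟨Q, hKQ, hQ⟩ := hfin.exists_le_maximal (a := (K : Set V))
    ⟨by exact_mod_cast hKS, hKG⟩
  have hQS : Q ⊆ S := hQ.prop.1
  refine hc Q ⟨hQ.prop.2, fun Q' hQ' hQQ' => ?_⟩ ?_ ⟨a, fun v hv => ?_⟩
  · intro x hx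
    by_contra hxQ
    have hins : G.IsClique (insert x Q) :=
      SimpleGraph.IsClique.subset (Set.insert_subset hx hQQ') hQ'
    by_cases hxS : x ∈ S
    · exact hxQ (hQ.le_of_ge ⟨Set.insert_subset (by exact_mod_cast hxS) hQS, hins⟩
        (Set.subset_insert _ _) (Set.mem_insert _ _))
    · refine hcon x (mem_compl.2 hxS) fun u hu => mem_filter.2 ⟨hKS hu, ?_⟩
      have hadj : G.Adj x u := hins (Set.mem_insert _ _) (Set.mem_insert_of_mem _ (hKQ hu))
        (fun h => hxS (h ▸ hKS hu))
      rw [hG, SimpleGraph.fromEdgeSet_adj] at hadj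
      exact hadj.1
  · obtain ⟨u, hu, v, hv, huv⟩ := one_lt_card.1
      (show 1 < #K by rw [(mem_powersetCard.1 hK).2]; omega)
    exact ⟨u, hKQ hu, v, hKQ hv, huv⟩
  · exact (mem_filter.1 (hSa (hQS hv))).2

lemma pairs_univ_eq (S : Finset V) :
    pairs (univ : Finset V) = crossing Sᶜ S ∪ (pairs S ∪ pairs Sᶜ) := by
  ext e
  induction e with
  | h u v =>
    simp only [mem_pairs, mem_union, mem_crossing, mem_univ, true_and, mem_compl]
    constructor
    · intro huv
      by_cases hu : u ∈ S <;> by_cases hv : v ∈ S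
      · exact Or.inr (Or.inl ⟨hu, hv, huv⟩)
      · exact Or.inl ⟨v, hv, u, hu, Sym2.eq_swap⟩
      · exact Or.inl ⟨u, hu, v, hv, rfl⟩
      · exact Or.inr (Or.inr ⟨hu, hv, huv⟩)
    · rintro (⟨v', hv', u', hu', h⟩ | ⟨-, -, h⟩ | ⟨-, -, h⟩)
      · rcases Sym2.eq_iff.1 h with ⟨rfl, rfl⟩ | ⟨rfl, rfl⟩
        · exact fun h => hv' (h ▸ hu')
        · exact fun h => hv' (h ▸ hu')
      · exact h
      · exact h

/-- The probability that `S` contains no clique of size `k` without common neighbors outside `S`,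
while the vertices outside `S` have at most `M` neighbors in `S`. -/
lemma bexp_covered_le (h0 : 0 ≤ p) (h1 : p ≤ 1) {k : ℕ} {S : Finset V} {lam M β t q : ℝ}
    (hlam : 0 ≤ lam)
    (hstep : ∀ U' ⊆ powersetCard k S, ∀ θ, 0 ≤ θ → θ ≤ lam →
      bexp p S (fun N => if (#N : ℝ) ≤ M then Real.exp (-(θ * #{K ∈ U' | ¬ K ⊆ N})) else 0) ≤
        Real.exp (-(θ * (1 - p ^ k) * #U') + β))
    (hq0 : 0 ≤ q) (hq1 : q ≤ 1) (hq : q * overlap p #S k ≤ 1 / 2) :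
    bexp p (pairs (univ : Finset V)) (fun E => if Covered E k M S then 1 else 0) ≤
      Real.exp (lam * t - lam * (1 - p ^ k) ^ #Sᶜ * (#S).choose k + #Sᶜ * β) +
        Real.exp (-(q / 2 * (t * p ^ k.choose 2))) := by
  have hWS : Disjoint Sᶜ S := disjoint_compl_left
  have hd1 : Disjoint (crossing Sᶜ S) (pairs S ∪ pairs Sᶜ) :=
    disjoint_union_right.2 ⟨disjoint_crossing_pairs hWS (Or.inl rfl),
      disjoint_crossing_pairs hWS (Or.inr rfl)⟩
  rw [pairs_univ_eq S, bexp_union p hd1]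
  have hfirst := bexp_card_uncovered_lt_le h0 h1 hWS (t := t) hlam hstep
  rw [card_powersetCard] at hfirst
  refine le_trans ?_ (add_le_add_left hfirst _)
  rw [← bexp_const p (crossing Sᶜ S) (Real.exp (-(q / 2 * (t * p ^ k.choose 2)))), ← bexp_add]
  refine bexp_mono h0 h1 fun E₁ hE₁ => ?_
  have hlink : ∀ E₂ ⊆ pairs S ∪ pairs Sᶜ, ∀ v ∈ Sᶜ, link (E₁ ∪ E₂) S v = link E₁ S v := by
    intro E₂ hE₂ v hv
    ext u
    simp only [link, mem_filter, mem_union]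
    refine and_congr_right fun hu => ⟨fun h => h.resolve_right fun h2 => ?_, Or.inl⟩
    have hmem : s(v, u) ∈ crossing Sᶜ S := mem_crossing.2 ⟨v, hv, u, hu, rfl⟩
    exact disjoint_left.1 hd1 hmem (hE₂ h2)
  set U := uncovered (powersetCard k S) E₁ S Sᶜ with hU
  have hUS : U ⊆ powersetCard k S := fun K hK => (mem_uncovered.1 hK).1
  by_cases hM : ∀ v ∈ Sᶜ, (#(link E₁ S v) : ℝ) ≤ M
  swap
  · have hz := bexp_congr p (T := pairs S ∪ pairs Sᶜ)
      (f := fun E₂ => if Covered (E₁ ∪ E₂) k M S then (1 : ℝ) else 0) (g := fun _ => 0)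
      fun E₂ hE₂ => if_neg fun h => hM fun v hv => by rw [← hlink E₂ hE₂ v hv]; exact h.1 v hv
    rw [hz, bexp_const]
    positivity
  by_cases ht : (#U : ℝ) < t
  · rw [if_pos ⟨hM, ht⟩]
    have : bexp p (pairs S ∪ pairs Sᶜ) (fun E₂ => if Covered (E₁ ∪ E₂) k M S then (1 : ℝ) else 0) ≤
        bexp p (pairs S ∪ pairs Sᶜ) (fun _ => 1) :=
      bexp_mono h0 h1 fun E₂ _ => by split_ifs <;> norm_num
    rw [bexp_const] at this
    have h2 := Real.exp_nonneg (-(q / 2 * (t * p ^ k.choose 2)))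
    linarith
  · rw [if_neg fun h => ht h.2, zero_add, bexp_union p (disjoint_pairs hWS).symm]
    have hjan := bexp_no_clique_le h0 h1 hUS hq0 hq1 hq
    refine le_trans ?_ (hjan.trans ?_)
    · refine bexp_mono h0 h1 fun E₂ hE₂ => ?_
      by_cases hno : ∀ K ∈ U, ¬ pairs K ⊆ E₂
      · rw [if_pos hno]
        refine (bexp_mono h0 h1 (g := fun _ => 1) fun E₃ _ => ?_).trans_eq (bexp_const _ _ _)
        split_ifs <;> norm_num
      · rw [if_neg hno]
        refine (bexp_mono h0 h1 (g := fun _ => 0) fun E₃ hE₃ => ?_).trans_eq (bexp_const _ _ _)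
        rw [if_neg]
        intro hcov
        refine hno fun K hK hKE => ?_
        obtain ⟨v, hv, hKv⟩ := hcov.2 K (hUS hK) (fun e he => by simp [hKE he])
        rw [hlink _ (union_subset_union hE₂ hE₃) v hv] at hKv
        exact (mem_uncovered.1 hK).2 v hv hKv
    · refine Real.exp_le_exp.2 (neg_le_neg ?_)
      have := not_lt.1 ht
      gcongr

/-- The probability that the degree of `v` is larger than `M`, for `M ≥ e² n p`. -/
lemma bexp_degree_le (h0 : 0 ≤ p) (h1 : p ≤ 1) {M : ℝ}
    (hM : Real.exp 2 * (Fintype.card V * p) ≤ M) (v : V) :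
    bexp p (pairs (univ : Finset V)) (fun E => if M < #(link E univ v) then 1 else 0)
      ≤ Real.exp (-M) := by
  have hM0 : 0 ≤ M := le_trans (by positivity) hM
  set m := ⌊M⌋₊ + 1 with hm
  have hMm : M ≤ m := by rw [hm]; push_cast; exact (Nat.lt_floor_add_one M).le
  set 𝒜 := powersetCard m (univ.erase v) with h𝒜
  have hsub : ∀ A ∈ 𝒜, A.map (pairEmb v) ⊆ pairs (univ : Finset V) := by
    intro A hA e he
    obtain ⟨u, hu, rfl⟩ := mem_map.1 he
    exact mem_pairs.2 ⟨mem_univ _, mem_univ _,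
      fun h => (mem_erase.1 ((mem_powersetCard.1 hA).1 hu)).1 h.symm⟩
  have hle : bexp p (pairs (univ : Finset V)) (fun E => if M < #(link E univ v) then 1 else 0) ≤
      ∑ A ∈ 𝒜, p ^ m := by
    calc _ ≤ bexp p (pairs (univ : Finset V))
          (fun E => ∑ A ∈ 𝒜, if A.map (pairEmb v) ⊆ E then 1 else 0) := by
          refine bexp_mono h0 h1 fun E hE => ?_
          split_ifs with h
          · obtain ⟨A, hA, hAm⟩ := exists_subset_card_eq (s := link E univ v) (n := m)
              (Nat.succ_le_of_lt ((Nat.floor_lt hM0).2 h))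
            have hA𝒜 : A ∈ 𝒜 := mem_powersetCard.2 ⟨fun u hu => mem_erase.2
              ⟨(mem_pairs.1 (hE (mem_filter.1 (hA hu)).2)).2.2.symm, mem_univ _⟩, hAm⟩
            refine le_trans ?_ (single_le_sum (fun B _ => ?_) hA𝒜)
            · rw [if_pos]
              intro e he
              obtain ⟨u, hu, rfl⟩ := mem_map.1 he
              exact (mem_filter.1 (hA hu)).2
            · split_ifs <;> norm_num
          · exact sum_nonneg fun B _ => by split_ifs <;> norm_num
      _ = _ := by
          rw [bexp_sum]
          refine sum_congr rfl fun A hA => ?_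
          rw [bexp_subset_one p (hsub A hA), card_map, (mem_powersetCard.1 hA).2]
  refine hle.trans ?_
  rw [sum_const, card_powersetCard, nsmul_eq_mul]
  have hc : (((#(univ.erase v)).choose m : ℕ) : ℝ) ≤ (Fintype.card V : ℝ) ^ m / m.factorial :=
    (Nat.cast_le.2 (Nat.choose_le_choose m (card_le_univ _))).trans (Nat.choose_le_pow_div _ _)
  have hfac : (m : ℝ) ^ m ≤ Real.exp m * m.factorial := by
    have := Real.pow_div_factorial_le_exp (x := (m : ℝ)) (Nat.cast_nonneg m) m
    rwa [div_le_iff₀ (by positivity)] at this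
  have hpow : Real.exp (2 * m) * (Fintype.card V * p) ^ m ≤ (m : ℝ) ^ m := by
    have : Real.exp (2 * m) = Real.exp 2 ^ m := by rw [← Real.exp_nat_mul]; ring_nf
    rw [this, ← mul_pow]
    gcongr
    exact hM.trans hMm
  have hkey : (Fintype.card V * p) ^ m ≤ Real.exp (-m) * m.factorial := by
    have h3 : Real.exp (2 * m) * (Fintype.card V * p) ^ m ≤
        Real.exp (2 * m) * (Real.exp (-m) * m.factorial) := by
      rw [← mul_assoc, ← Real.exp_add, show (2 * m + -m : ℝ) = m by ring]
      exact hpow.trans hfac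
    exact le_of_mul_le_mul_left h3 (Real.exp_pos _)
  calc _ ≤ (Fintype.card V : ℝ) ^ m / m.factorial * p ^ m := by gcongr
    _ = (Fintype.card V * p) ^ m / m.factorial := by rw [mul_pow]; ring
    _ ≤ Real.exp (-m) := by rwa [div_le_iff₀ (by positivity)]
    _ ≤ _ := Real.exp_le_exp.2 (neg_le_neg hMm)

end BadSets

section Probability

variable {V : Type*} [DecidableEq V] [Fintype V]

open Classical in
lemma binomialRandom_real_eq_bexp (p : unitInterval) (𝒮 : Set (SimpleGraph V)) :
    (SimpleGraph.binomialRandom V p).real 𝒮 = bexp (p : ℝ) (pairs (univ : Finset V))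
      (fun E => if SimpleGraph.fromEdgeSet (E : Set (Sym2 V)) ∈ 𝒮 then 1 else 0) := by
  have hsing : ∀ G : SimpleGraph V, (SimpleGraph.binomialRandom V p).real {G} =
      (p : ℝ) ^ #G.edgeFinset * (1 - p) ^ (#(pairs (univ : Finset V)) - #G.edgeFinset) := by
    intro G
    rw [MeasureTheory.measureReal_def, SimpleGraph.binomialRandom_singleton, card_pairs, card_univ,
      ← SimpleGraph.coe_edgeFinset, Set.ncard_coe_finset, Nat.card_eq_fintype_card]
    simp
  have hmeas : MeasurableSingletonClass (SimpleGraph V) := ⟨fun G => by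
    have h := SimpleGraph.measurable_edgeSet (measurableSet_singleton G.edgeSet)
    rwa [← Set.image_singleton, SimpleGraph.edgeSet_injective.preimage_image] at h⟩
  have h1 : (SimpleGraph.binomialRandom V p).real 𝒮 =
      ∑ G ∈ 𝒮.toFinset, (SimpleGraph.binomialRandom V p).real {G} := by
    rw [MeasureTheory.sum_measureReal_singleton, Set.coe_toFinset]
  rw [h1, bexp]
  simp only [mul_ite, mul_one, mul_zero]
  rw [← sum_filter]
  refine sum_bij' (fun G _ => G.edgeFinset)
    (fun E _ => SimpleGraph.fromEdgeSet (E : Set (Sym2 V))) ?_ ?_ ?_ ?_ ?_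
  · intro G hG
    refine mem_filter.2 ⟨mem_powerset.2 fun e he => ?_, ?_⟩
    · induction e with
      | h u v =>
        rw [SimpleGraph.mem_edgeFinset, SimpleGraph.mem_edgeSet] at he
        exact mem_pairs.2 ⟨mem_univ _, mem_univ _, he.ne⟩
    · simpa using hG
  · intro E hE
    simpa using (mem_filter.1 hE).2
  · intro G _
    simp
  · intro E hE
    have hsub := mem_powerset.1 (mem_filter.1 hE).1
    ext e
    simp only [SimpleGraph.edgeFinset, Set.mem_toFinset]
    induction e with
    | h u v =>
      rw [SimpleGraph.mem_edgeSet, SimpleGraph.fromEdgeSet_adj]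
      exact ⟨fun h => h.1, fun h => ⟨h, (mem_pairs.1 (hsub h)).2.2⟩⟩
  · intro G _
    exact hsing G

lemma binomialRandom_real_chromatic_lt_le (p : unitInterval) {k s : ℕ} (hk : 2 ≤ k) {M ε : ℝ}
    (hM : Real.exp 2 * (Fintype.card V * p) ≤ M)
    (hε : ∀ S ∈ powersetCard s (univ : Finset V),
      bexp p (pairs (univ : Finset V)) (fun E => if Covered E k M S then 1 else 0) ≤ ε) :
    (SimpleGraph.binomialRandom V p).real
      {G | cliqueChromaticNumber G * (s - 1) < Fintype.card V} ≤
      Fintype.card V * Real.exp (-M) + (Fintype.card V).choose s * ε := by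
  classical
  have h0 := p.2.1
  have h1 := p.2.2
  rw [binomialRandom_real_eq_bexp]
  calc _ ≤ bexp p (pairs (univ : Finset V)) (fun E =>
        ∑ v : V, (if M < #(link E univ v) then 1 else 0) +
        ∑ S ∈ powersetCard s (univ : Finset V), if Covered E k M S then 1 else 0) := by
        refine bexp_mono h0 h1 fun E _ => ?_
        have hA : 0 ≤ ∑ v : V, (if M < #(link E univ v) then (1 : ℝ) else 0) :=
          sum_nonneg fun v _ => by split_ifs <;> norm_num
        have hB : 0 ≤ ∑ S ∈ powersetCard s (univ : Finset V),
            if Covered E k M S then (1 : ℝ) else 0 :=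
          sum_nonneg fun v _ => by split_ifs <;> norm_num
        split_ifs with h
        · by_cases hdeg : ∀ v, (#(link E univ v) : ℝ) ≤ M
          · obtain ⟨c, hc⟩ := cliqueChromaticNumber_spec
              (SimpleGraph.fromEdgeSet (E : Set (Sym2 V)))
            obtain ⟨S, hS, hcov⟩ := exists_covered_of_isCliqueColoring hk hdeg hc h
            have := single_le_sum (f := fun S => if Covered E k M S then (1 : ℝ) else 0)
              (fun S _ => by positivity) hS
            simp only [if_pos hcov] at this
            linarith
          · push Not at hdeg
            obtain ⟨v, hv⟩ := hdeg
            have := single_le_sum (f := fun v => if M < #(link E univ v) then (1 : ℝ) else 0)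
              (fun v _ => by positivity) (mem_univ v)
            simp only [if_pos hv] at this
            linarith
        · positivity
    _ = ∑ v : V, bexp p (pairs (univ : Finset V)) (fun E => if M < #(link E univ v) then 1 else 0) +
        ∑ S ∈ powersetCard s (univ : Finset V),
          bexp p (pairs (univ : Finset V)) (fun E => if Covered E k M S then 1 else 0) := by
        rw [bexp_add, bexp_sum, bexp_sum]
    _ ≤ ∑ v : V, Real.exp (-M) + ∑ S ∈ powersetCard s (univ : Finset V), ε := by
        gcongr with v _ S hS
        · exact bexp_degree_le h0 h1 hM v
        · exact hε S hS
    _ = _ := by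
        rw [sum_const, sum_const, card_powersetCard, nsmul_eq_mul, nsmul_eq_mul, card_univ]

end Probability

section Estimates

lemma pow_div_two_mul_factorial_le_choose {s k : ℕ} (h : 2 * k ^ 2 ≤ s) :
    (s : ℝ) ^ k / (2 * k.factorial) ≤ s.choose k := by
  rcases Nat.eq_zero_or_pos k with rfl | hk
  · norm_num
  have hks : k ≤ s := by nlinarith
  have hs : (0 : ℝ) < s := by
    have : 0 < s := by omega
    exact_mod_cast this
  refine le_trans ?_ (Nat.pow_le_choose (α := ℝ) k s)
  have hcast : ((s + 1 - k : ℕ) : ℝ) = (s : ℝ) + 1 - k := by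
    rw [Nat.cast_sub (by omega)]; push_cast; ring
  have hbern : (s : ℝ) ^ k / 2 ≤ ((s : ℝ) + 1 - k) ^ k := by
    have hk2 : 2 * (k : ℝ) ^ 2 ≤ s := by exact_mod_cast h
    have hk1 : (1 : ℝ) ≤ k := by exact_mod_cast hk
    have hb := one_add_mul_le_pow (a := -((k : ℝ) / s)) (by
      have : (k : ℝ) / s ≤ 1 := by rw [div_le_one hs]; exact_mod_cast hks
      linarith) k
    have h1 : (1 : ℝ) / 2 ≤ 1 + k * -((k : ℝ) / s) := by
      have : (k : ℝ) * (k / s) ≤ 1 / 2 := by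
        rw [← mul_div_assoc, div_le_iff₀ hs]; nlinarith
      linarith
    calc (s : ℝ) ^ k / 2 = s ^ k * (1 / 2) := by ring
      _ ≤ s ^ k * (1 + -((k : ℝ) / s)) ^ k := by
        gcongr; exact h1.trans hb
      _ = (s - k) ^ k := by
        rw [← mul_pow]
        congr 1
        field_simp
        ring
      _ ≤ _ := by
        have : (k : ℝ) ≤ s := by exact_mod_cast hks
        gcongr
        linarith
  rw [hcast]
  calc (s : ℝ) ^ k / (2 * k.factorial) = s ^ k / 2 / k.factorial := by rw [div_div]
    _ ≤ _ := by gcongr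

lemma pow_le_exp_mul_factorial (m : ℕ) : (m : ℝ) ^ m ≤ Real.exp m * m.factorial := by
  have := Real.pow_div_factorial_le_exp (x := (m : ℝ)) (Nat.cast_nonneg m) m
  rwa [div_le_iff₀ (by positivity)] at this

lemma choose_le_exp {n s : ℕ} (hs : 0 < s) (hn : 0 < n) :
    (n.choose s : ℝ) ≤ Real.exp (s * Real.log (Real.exp 1 * n / s)) := by
  have hs' : (0 : ℝ) < s := by exact_mod_cast hs
  have hn' : (0 : ℝ) < n := by exact_mod_cast hn
  have h1 : Real.exp (s * Real.log (Real.exp 1 * n / s)) = (Real.exp 1 * n / s) ^ s := by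
    rw [Real.exp_nat_mul, Real.exp_log (by positivity)]
  rw [h1]
  refine (Nat.choose_le_pow_div s n).trans ?_
  rw [div_pow, mul_pow, ← Real.exp_nat_mul, mul_one, div_le_div_iff₀ (by positivity)
    (by positivity)]
  have := pow_le_exp_mul_factorial s
  calc (n : ℝ) ^ s * s ^ s ≤ n ^ s * (Real.exp s * s.factorial) := by gcongr
    _ = _ := by ring

/-- A positive sequence with increasing ratios is largest at the ends of an interval. -/
lemma le_max_of_ratio_mono {a : ℕ → ℝ} (ha : ∀ j, 0 < a j) {b : ℕ}
    (h : ∀ j, b ≤ j → a (j + 1) / a j ≤ a (j + 2) / a (j + 1)) {j k : ℕ} (hbj : b ≤ j)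
    (hjk : j ≤ k) : a j ≤ max (a b) (a k) := by
  have hmono : ∀ i j, b ≤ i → i ≤ j → a (i + 1) / a i ≤ a (j + 1) / a j := by
    intro i j hi hij
    induction j, hij using Nat.le_induction with
    | base => exact le_rfl
    | succ m hm ih => exact ih.trans (h m (hi.trans hm))
  rcases le_total 1 (a (j + 1) / a j) with hr | hr
  · refine le_max_of_le_right ?_
    induction k, hjk using Nat.le_induction with
    | base => exact le_rfl
    | succ m hm ih => exact ih.trans ((one_le_div (ha m)).1 (hr.trans (hmono j m hbj hm)))
  · refine le_max_of_le_left ?_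
    induction j, hbj using Nat.le_induction with
    | base => exact le_rfl
    | succ m hm ih =>
      have h1 : a (m + 1) / a m ≤ 1 := (hmono m (m + 1) hm (Nat.le_succ m)).trans hr
      exact ((div_le_one (ha m)).1 h1).trans (ih (by omega) h1)

lemma overlap_mul_le {p : ℝ} (h0 : 0 < p) (h1 : p ≤ 1 / 2) {s k : ℕ} (hs : 0 < s) {γ : ℝ}
    (h2 : (k : ℝ) ^ 4 / (s * p) ≤ γ)
    (hk : (k : ℝ) ^ (2 * k) / (k.factorial * s ^ (k - 1) * p ^ k.choose 2) ≤ γ) :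
    k.factorial * overlap p s k ≤ s ^ (k - 1) * p ^ k.choose 2 * (k * γ) := by
  rcases Nat.lt_or_ge k 3 with hk3 | hk3
  · have hov : overlap p s k = 0 := by
      rw [overlap, Ico_eq_empty (by omega), sum_empty]
    have : 0 ≤ γ := le_trans (by positivity) h2
    rw [hov, mul_zero]; positivity
  have hs' : (0 : ℝ) < s := by exact_mod_cast hs
  have hkpos : (0 : ℝ) < k := by exact_mod_cast (by omega : 0 < k)
  set a : ℕ → ℝ := fun j => (k : ℝ) ^ (2 * j) / (j.factorial * s ^ (j - 1) * p ^ j.choose 2)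
    with ha
  have hapos : ∀ j, 0 < a j := fun j => by simp only [ha]; positivity
  have hstep : ∀ j, 2 ≤ j → a (j + 1) / a j = k ^ 2 / ((j + 1) * s * p ^ j) := by
    intro j hj
    obtain ⟨i, rfl⟩ : ∃ i, j = i + 1 := ⟨j - 1, by omega⟩
    have hc : (i + 1 + 1).choose 2 = (i + 1).choose 2 + (i + 1) := by
      rw [Nat.choose_succ_succ' (i + 1) 1, Nat.choose_one_right, add_comm]
    simp only [ha, hc, Nat.factorial_succ (i + 1), Nat.add_sub_cancel]
    push_cast
    rw [pow_add p, pow_succ (s : ℝ) i]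
    field_simp
    ring
  have hratio : ∀ j, 2 ≤ j → a (j + 1) / a j ≤ a (j + 2) / a (j + 1) := by
    intro j hj
    rw [hstep j hj, hstep (j + 1) (by omega)]
    refine div_le_div_of_nonneg_left (by positivity) (by positivity) ?_
    push_cast
    have hj' : (0 : ℝ) ≤ j := by positivity
    have : ((j : ℝ) + 1 + 1) * p ≤ j + 1 := by nlinarith
    calc ((j : ℝ) + 1 + 1) * s * p ^ (j + 1) = ((j : ℝ) + 1 + 1) * p * (s * p ^ j) := by ring
      _ ≤ (j + 1) * (s * p ^ j) := by gcongr
      _ = _ := by ring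
  have ha2 : a 2 ≤ γ := by
    refine le_trans ?_ h2
    simp only [ha]
    norm_num
    gcongr
    nlinarith [mul_pos hs' h0]
  have hterm : ∀ j ∈ Ico 2 k, (k.factorial : ℝ) * (k.choose j * ((s : ℝ) ^ (k - j) /
      (k - j).factorial * p ^ (k.choose 2 - j.choose 2))) ≤
      s ^ (k - 1) * p ^ k.choose 2 * γ := by
    intro j hj
    obtain ⟨hj2, hjk⟩ := mem_Ico.1 hj
    have haj : a j ≤ γ := (le_max_of_ratio_mono hapos hratio hj2 hjk.le).trans (max_le ha2 hk)
    refine le_trans ?_ (mul_le_mul_of_nonneg_left haj (by positivity))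
    have hs1 : (s : ℝ) ^ (k - 1) = s ^ (k - j) * s ^ (j - 1) := by rw [← pow_add]; congr 1; omega
    have hp1 : p ^ k.choose 2 = p ^ (k.choose 2 - j.choose 2) * p ^ j.choose 2 := by
      rw [← pow_add]; congr 1
      exact (Nat.sub_add_cancel (Nat.choose_le_choose 2 hjk.le)).symm
    have hdesc : (k.factorial : ℝ) ≤ k ^ j * (k - j).factorial := by
      rw [← Nat.factorial_mul_descFactorial hjk.le]
      push_cast
      rw [mul_comm]
      gcongr
      exact_mod_cast Nat.descFactorial_le_pow k j
    have hch : (k.choose j : ℝ) ≤ k ^ j / j.factorial := Nat.choose_le_pow_div j k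
    calc _ ≤ (k ^ j * (k - j).factorial : ℝ) * ((k ^ j / j.factorial) * ((s : ℝ) ^ (k - j) /
      (k - j).factorial * p ^ (k.choose 2 - j.choose 2))) := by gcongr
      _ = _ := by
        simp only [ha]
        rw [hs1, hp1, two_mul, pow_add (k : ℝ)]
        field_simp
  rw [overlap, mul_sum]
  refine (sum_le_sum hterm).trans ?_
  rw [sum_const, Nat.card_Ico, nsmul_eq_mul]
  have hγ : 0 ≤ γ := le_trans (by positivity) h2
  have hle : ((k - 2 : ℕ) : ℝ) ≤ k := by exact_mod_cast Nat.sub_le k 2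
  calc ((k - 2 : ℕ) : ℝ) * (s ^ (k - 1) * p ^ k.choose 2 * γ)
      ≤ k * (s ^ (k - 1) * p ^ k.choose 2 * γ) := by gcongr
    _ = _ := by ring

end Estimates

/-- The inequalities between the parameters that are used in the union bound over the sets of
`s` vertices. Here `δ` is a lower bound for the probability that `k` vertices have no common
neighbor. -/
structure Regime (n s k : ℕ) (p δ : ℝ) : Prop where
  p_pos : 0 < p
  p_le : p ≤ 1 / 2
  two_le : 2 ≤ k
  s_pos : 0 < s
  s_le : s ≤ n
  δ_pos : 0 < δ
  δ_le : δ ≤ 1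
  one_le_log : 1 ≤ Real.log (1 / p)
  log_le : Real.log (1 / p) ≤ n * p
  degree : (10 ^ 4 * (n * p)) ^ (k - 1) ≤ s ^ (k - 1) * δ
  degree' : 10 ^ 4 * (n * p) ≤ s
  cliques : (10 ^ 4) ^ (k - 1) * (k.factorial * k * Real.log (1 / p)) ≤
    s ^ (k - 1) * p ^ k.choose 2 * δ
  exposure : (6 * 10 ^ 4) ^ (2 * (k - 1)) * (k ^ 2 * Real.log (1 / p) * n * p) *
    p ^ (2 * (k - 1)) ≤ δ ^ 2
  overlaps : 10 ^ 4 * (k ^ 2 * Real.log (1 / p)) ≤ s * p * δ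
  overlaps' : 3 ≤ k → 10 ^ 4 * (k ^ 5 * Real.log (1 / p)) ≤ s * p * δ

namespace Regime

variable {n s k : ℕ} {p δ : ℝ}

lemma n_pos (h : Regime n s k p δ) : 0 < n := h.s_pos.trans_le h.s_le

/-- The logarithm of `n.choose s` is at most `s * ent n s`. -/
noncomputable def ent (n s : ℕ) : ℝ := Real.log (Real.exp 1 * n / s)

lemma exp_ent (h : Regime n s k p δ) : Real.exp (ent n s) = Real.exp 1 * n / s := by
  have hs : (0 : ℝ) < s := by exact_mod_cast h.s_pos
  have hn : (0 : ℝ) < n := by exact_mod_cast h.n_pos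
  exact Real.exp_log (by positivity)

lemma one_le_ent (h : Regime n s k p δ) : 1 ≤ ent n s := by
  have hs : (0 : ℝ) < s := by exact_mod_cast h.s_pos
  have hn : (s : ℝ) ≤ n := by exact_mod_cast h.s_le
  rw [← Real.exp_le_exp, h.exp_ent, le_div_iff₀ hs]
  gcongr

lemma ent_le_log (h : Regime n s k p δ) : ent n s ≤ Real.log (1 / p) := by
  have hs : (0 : ℝ) < s := by exact_mod_cast h.s_pos
  have hp := h.p_pos
  have hn : (0 : ℝ) < n := by exact_mod_cast h.n_pos
  refine Real.log_le_log (by positivity) ?_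
  rw [div_le_div_iff₀ hs hp, one_mul]
  have he : Real.exp 1 ≤ 10 ^ 4 := by
    have := Real.exp_one_lt_d9; linarith
  calc Real.exp 1 * n * p = Real.exp 1 * (n * p) := by ring
    _ ≤ 10 ^ 4 * (n * p) := by gcongr
    _ ≤ s := h.degree'

lemma le_choose (h : Regime n s k p δ) : (s : ℝ) ^ k / (2 * k.factorial) ≤ s.choose k := by
  refine pow_div_two_mul_factorial_le_choose ?_
  have hov := h.overlaps
  have hs : (0 : ℝ) < s := by exact_mod_cast h.s_pos
  have h1 : (s : ℝ) * p * δ ≤ s := by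
    rw [mul_assoc]
    have := mul_le_one₀ (h.p_le.trans (by norm_num)) h.δ_pos.le h.δ_le
    exact mul_le_of_le_one_right hs.le this
  have hk : (0 : ℝ) ≤ (k : ℝ) ^ 2 := by positivity
  have h2 : 2 * (k : ℝ) ^ 2 ≤ s := by nlinarith [h.one_le_log]
  exact_mod_cast h2

/-- The parameter of the Laplace transform. -/
noncomputable def rate (n s k : ℕ) (δ : ℝ) : ℝ := 8 * s * ent n s / (s.choose k * δ)

lemma choose_pos (h : Regime n s k p δ) : (0 : ℝ) < s.choose k := by
  have hs : (0 : ℝ) < s := by exact_mod_cast h.s_pos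
  exact lt_of_lt_of_le (by positivity) h.le_choose

lemma rate_nonneg (h : Regime n s k p δ) : 0 ≤ rate n s k δ := by
  have := h.choose_pos
  have := h.δ_pos
  have := h.one_le_ent
  unfold rate
  positivity

lemma rate_le (h : Regime n s k p δ) :
    rate n s k δ ≤ 16 * ent n s * k.factorial / (s ^ (k - 1) * δ) := by
  have hs : (0 : ℝ) < s := by exact_mod_cast h.s_pos
  have hc := h.le_choose
  have hδ := h.δ_pos
  have he : 0 < ent n s := by linarith [h.one_le_ent]
  have hsk : (s : ℝ) ^ k = s ^ (k - 1) * s := by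
    rw [← pow_succ]; congr 1; have := h.two_le; omega
  unfold rate
  calc 8 * s * ent n s / (s.choose k * δ) ≤
      8 * s * ent n s / ((s : ℝ) ^ k / (2 * k.factorial) * δ) := by gcongr
    _ = _ := by rw [hsk]; field_simp; norm_num

/-- The number of members of the family inside the neighborhood changes by at most this much
when a single vertex is added to the neighborhood. -/
noncomputable def lip (s k : ℕ) (p : ℝ) : ℝ :=
  (Real.exp 3 * (s * p) + s * p) ^ (k - 1) / (k - 1).factorial

lemma exp_three_lt : Real.exp 3 < 21 := by
  have h : Real.exp 3 = Real.exp 1 ^ 3 := by rw [← Real.exp_nat_mul]; norm_num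
  have h2 := Real.exp_one_lt_d9
  have h3 : Real.exp 1 < 2.7183 := by linarith
  rw [h]
  calc Real.exp 1 ^ 3 < 2.7183 ^ 3 := by gcongr
    _ < 21 := by norm_num

lemma exp_two_lt : Real.exp 2 < 8 := by
  have h : Real.exp 2 = Real.exp 1 ^ 2 := by rw [← Real.exp_nat_mul]; norm_num
  have h2 := Real.exp_one_lt_d9
  have h3 : Real.exp 1 < 2.7183 := by linarith
  rw [h]
  calc Real.exp 1 ^ 2 < 2.7183 ^ 2 := by gcongr
    _ < 8 := by norm_num

lemma rate_mul_lip_sq_le (h : Regime n s k p δ) :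
    n * p * (rate n s k δ * lip s k p) ^ 2 ≤ ent n s := by
  have hs : (0 : ℝ) < s := by exact_mod_cast h.s_pos
  have hn : (0 : ℝ) < n := by exact_mod_cast h.n_pos
  have hp := h.p_pos
  have hδ := h.δ_pos
  have he1 := h.one_le_ent
  have hL := h.ent_le_log
  set L := Real.log (1 / p) with hLdef
  have hL1 : 1 ≤ L := h.one_le_log
  set e := ent n s with hedef
  obtain ⟨i, hi⟩ : ∃ i, k = i + 2 := ⟨k - 2, by have := h.two_le; omega⟩
  have hfac : (k.factorial : ℝ) = k * (k - 1).factorial := by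
    rw [← Nat.mul_factorial_pred (by omega)]; push_cast; ring
  have hlip : lip s k p ≤ 22 ^ (k - 1) * s ^ (k - 1) * p ^ (k - 1) / (k - 1).factorial := by
    unfold lip
    rw [← mul_pow, ← mul_pow]
    have : Real.exp 3 * (s * p) + s * p ≤ 22 * s * p := by
      have := exp_three_lt
      nlinarith [mul_pos hs hp]
    gcongr
  have hlip0 : 0 ≤ lip s k p := by unfold lip; positivity
  have hprod : rate n s k δ * lip s k p ≤ 16 * e * k * (22 * p) ^ (k - 1) / δ := by
    calc _ ≤ 16 * e * k.factorial / (s ^ (k - 1) * δ) *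
        (22 ^ (k - 1) * s ^ (k - 1) * p ^ (k - 1) / (k - 1).factorial) :=
          mul_le_mul h.rate_le hlip hlip0 (by positivity)
      _ = _ := by rw [hfac, mul_pow]; field_simp
  have hsq : (rate n s k δ * lip s k p) ^ 2 ≤ (16 * e * k * (22 * p) ^ (k - 1) / δ) ^ 2 := by
    have := h.rate_nonneg
    gcongr
  have hexp := h.exposure
  rw [← hLdef] at hexp
  have hpow : (484 : ℝ) ^ (k - 1) * 256 ≤ (6 * 10 ^ 4) ^ (2 * (k - 1)) := by
    rw [pow_mul]
    have h1 : k - 1 = i + 1 := by omega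
    rw [h1]
    calc (484 : ℝ) ^ (i + 1) * 256 = 484 ^ i * (484 * 256) := by ring
      _ ≤ ((6 * 10 ^ 4) ^ 2) ^ i * (6 * 10 ^ 4) ^ 2 := by gcongr <;> norm_num
      _ = _ := by ring
  have hmain : n * p * (16 * e * k * (22 * p) ^ (k - 1)) ^ 2 ≤ e * δ ^ 2 := by
    have e1 : n * p * (16 * e * k * (22 * p) ^ (k - 1)) ^ 2 =
        e * ((484 ^ (k - 1) * 256) * (k ^ 2 * e * n * p) * p ^ (2 * (k - 1))) := by
      rw [mul_pow, mul_pow, mul_pow, ← pow_mul, mul_comm (k - 1) 2, mul_pow, pow_mul (22 : ℝ)]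
      norm_num
      ring
    rw [e1]
    refine mul_le_mul_of_nonneg_left (le_trans ?_ hexp) (by linarith)
    gcongr
  calc _ ≤ n * p * (16 * e * k * (22 * p) ^ (k - 1) / δ) ^ 2 := by gcongr
    _ = n * p * (16 * e * k * (22 * p) ^ (k - 1)) ^ 2 / δ ^ 2 := by rw [div_pow]; ring
    _ ≤ e := by rwa [div_le_iff₀ (by positivity)]

lemma rate_mul_lip_le_one (h : Regime n s k p δ) : rate n s k δ * lip s k p ≤ 1 := by
  have h1 := h.rate_mul_lip_sq_le
  have h2 := h.ent_le_log.trans h.log_le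
  have hnp : 0 < n * p := by linarith [h.one_le_log, h.log_le]
  have h3 : (rate n s k δ * lip s k p) ^ 2 ≤ 1 := by
    have : n * p * (rate n s k δ * lip s k p) ^ 2 ≤ n * p * 1 := by linarith
    exact le_of_mul_le_mul_left this hnp
  exact (abs_le_one_iff_mul_self_le_one.2 (by nlinarith) |> abs_le.1).2

/-- Vertices with more than `e³ s p` neighbors in a set of size `s` contribute little. -/
lemma sum_high_degree_le (h : Regime n s k p δ) :
    ∑ d ∈ range (s + 1), s.choose d * p ^ d *
      (if Real.exp 3 * (s * p) < d ∧ (d : ℝ) ≤ Real.exp 2 * (n * p) then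
        Real.exp (rate n s k δ * d.choose k) else 0) ≤
      3 * Real.exp (-(Real.exp 3 * (s * p) / 2)) := by
  have hs : (0 : ℝ) < s := by exact_mod_cast h.s_pos
  have hn : (0 : ℝ) < n := by exact_mod_cast h.n_pos
  have hp := h.p_pos
  have hδ := h.δ_pos
  have he1 := h.one_le_ent
  have hexpent := h.exp_ent
  have hdeg := h.degree
  have hrate := h.rate_le
  have hrate0 := h.rate_nonneg
  set e := ent n s with hedef
  set M := Real.exp 2 * (n * p) with hM
  set D := Real.exp 3 * (s * p) with hD
  have hD0 : 0 < D := by positivity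
  have hM0 : 0 < M := by positivity
  obtain ⟨i, hi⟩ : ∃ i, k = i + 2 := ⟨k - 2, by have := h.two_le; omega⟩
  have hterm : ∀ d ∈ range (s + 1), s.choose d * p ^ d *
      (if D < d ∧ (d : ℝ) ≤ M then Real.exp (rate n s k δ * d.choose k) else 0) ≤
      Real.exp (-(D / 2)) * (2 / 3) ^ d := by
    intro d _
    split_ifs with hd
    swap
    · rw [mul_zero]; positivity
    obtain ⟨hDd, hdM⟩ := hd
    have hd0 : (0 : ℝ) < d := hD0.trans hDd
    set x := d / (Real.exp 1 * (s * p)) with hx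
    have hx0 : 0 < x := by positivity
    have hx2 : Real.exp 2 ≤ x := by
      rw [hx, le_div_iff₀ (by positivity), ← mul_assoc, ← Real.exp_add]
      norm_num
      exact hDd.le
    have hMx : Real.exp e * (Real.exp 1 * (s * p)) = M := by
      rw [hexpent, hM, show (2 : ℝ) = 1 + 1 by norm_num, Real.exp_add]
      field_simp
    have hxe : x ≤ Real.exp e := by
      rw [hx, div_le_iff₀ (by positivity), hMx]; exact hdM
    have hdx : (d : ℝ) / M = x / Real.exp e := by
      rw [hx, ← hMx]; field_simp
    have hlogx : 2 ≤ Real.log x := (Real.le_log_iff_exp_le hx0).2 hx2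
    have hanti : e / Real.exp e ≤ Real.log x / x := by
      have := Real.log_div_self_antitoneOn (a := x) (b := Real.exp e)
        (le_trans (Real.exp_le_exp.2 (by norm_num)) hx2)
        (le_trans (le_trans (Real.exp_le_exp.2 (by norm_num)) hx2) hxe) hxe
      simpa using this
    have hanti' : e * (d / M) ≤ Real.log x := by
      rw [hdx]
      rw [div_le_div_iff₀ (Real.exp_pos _) hx0] at hanti
      rw [mul_div_assoc', div_le_iff₀ (Real.exp_pos _)]
      exact hanti
    have hchoose : (s.choose d : ℝ) * p ^ d ≤ Real.exp (-(d * Real.log x)) := by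
      have e1 : Real.exp (-(d * Real.log x)) = (Real.exp 1 * (s * p) / d) ^ d := by
        rw [← mul_neg, Real.exp_nat_mul, ← Real.log_inv, Real.exp_log (by positivity), hx, inv_div]
      rw [e1]
      refine (mul_le_mul_of_nonneg_right (Nat.choose_le_pow_div d s) (by positivity)).trans ?_
      rw [div_pow, mul_pow, ← Real.exp_nat_mul, mul_one, div_mul_eq_mul_div, ← mul_pow,
        div_le_div_iff₀ (by positivity) (by positivity)]
      calc (s * p) ^ d * (d : ℝ) ^ d ≤ (s * p) ^ d * (Real.exp d * d.factorial) := by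
            gcongr; exact pow_le_exp_mul_factorial d
        _ = _ := by ring
    have hcount : rate n s k δ * d.choose k ≤ d * Real.log x / 2 := by
      have hdk : (d : ℝ) ^ k = d ^ (k - 1) * d := by
        rw [← pow_succ]; congr 1; omega
      have hpow : (d : ℝ) ^ (k - 1) ≤ (s ^ (k - 1) * δ) / 32 * (d / M) := by
        have hdM1 : (d : ℝ) / M ≤ 1 := (div_le_one hM0).2 hdM
        have e1 : (d : ℝ) ^ (k - 1) = M ^ (k - 1) * (d / M) ^ (k - 1) := by
          rw [← mul_pow]; congr 1; field_simp
        have e2 : ((d : ℝ) / M) ^ (k - 1) ≤ d / M :=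
          pow_le_of_le_one (by positivity) hdM1 (by omega)
        have e3 : M ^ (k - 1) ≤ (s ^ (k - 1) * δ) / 32 := by
          have hMle : M ≤ (10 ^ 4 * (n * p)) / 32 := by
            have := exp_two_lt
            have hnp : 0 < n * p := by positivity
            rw [hM]; nlinarith
          have h32 : (32 : ℝ) ≤ 32 ^ (k - 1) := le_self_pow₀ (by norm_num) (by omega)
          calc M ^ (k - 1) ≤ ((10 ^ 4 * (n * p)) / 32) ^ (k - 1) := by gcongr
            _ = (10 ^ 4 * (n * p)) ^ (k - 1) / 32 ^ (k - 1) := div_pow _ _ _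
            _ ≤ (s ^ (k - 1) * δ) / 32 := by gcongr
        rw [e1]
        gcongr
      calc rate n s k δ * d.choose k ≤ 16 * e * k.factorial / (s ^ (k - 1) * δ) *
            (d ^ k / k.factorial) := by
            gcongr
            exact Nat.choose_le_pow_div k d
        _ = 16 * e * d / (s ^ (k - 1) * δ) * d ^ (k - 1) := by rw [hdk]; field_simp
        _ ≤ 16 * e * d / (s ^ (k - 1) * δ) * ((s ^ (k - 1) * δ) / 32 * (d / M)) := by gcongr
        _ = d * (e * (d / M)) / 2 := by field_simp; norm_num
        _ ≤ _ := by gcongr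
    have h23 : Real.exp (-(1 / 2)) ≤ 2 / 3 := by
      rw [Real.exp_neg, inv_le_comm₀ (Real.exp_pos _) (by norm_num)]
      have := Real.add_one_le_exp (1 / 2 : ℝ)
      norm_num at this ⊢
      linarith
    calc _ ≤ Real.exp (-(d * Real.log x)) * Real.exp (d * Real.log x / 2) := by gcongr
      _ = Real.exp (-(d * Real.log x / 2)) := by rw [← Real.exp_add]; ring_nf
      _ ≤ Real.exp (-(D / 2) + d * (-(1 / 2))) := by
          refine Real.exp_le_exp.2 ?_
          nlinarith
      _ = Real.exp (-(D / 2)) * Real.exp (-(1 / 2)) ^ d := by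
          rw [Real.exp_add, Real.exp_nat_mul]
      _ ≤ _ := by gcongr
  refine (sum_le_sum hterm).trans ?_
  rw [← mul_sum, mul_comm 3]
  refine mul_le_mul_of_nonneg_left ?_ (Real.exp_nonneg _)
  rw [geom_sum_eq (by norm_num)]
  have : (0 : ℝ) ≤ (2 / 3) ^ (s + 1) := by positivity
  rw [div_le_iff_of_neg (by norm_num)]
  linarith

lemma exp_three_ge : 20 ≤ Real.exp 3 := by
  have h : Real.exp 3 = Real.exp 1 ^ 3 := by rw [← Real.exp_nat_mul]; norm_num
  have h2 := Real.exp_one_gt_d9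
  have h3 : 2.718 < Real.exp 1 := by linarith
  rw [h]
  calc (20 : ℝ) ≤ 2.718 ^ 3 := by norm_num
    _ ≤ _ := by gcongr

lemma n_mul_high_degree_le (h : Regime n s k p δ) :
    n * (3 * Real.exp (-(Real.exp 3 * (s * p) / 2))) ≤ s := by
  have hs : (0 : ℝ) < s := by exact_mod_cast h.s_pos
  have hn : (0 : ℝ) < n := by exact_mod_cast h.n_pos
  have hp := h.p_pos
  have hsp : Real.log (1 / p) ≤ s * p := by
    have h1 := h.overlaps
    have h2 : s * p * δ ≤ s * p := mul_le_of_le_one_right (by positivity) h.δ_le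
    have hk : (1 : ℝ) ≤ (k : ℝ) ^ 2 := by
      have : (1 : ℝ) ≤ k := by exact_mod_cast (by have := h.two_le; omega : 1 ≤ k)
      nlinarith
    nlinarith [h.one_le_log]
  have hexp : Real.exp (-(Real.exp 3 * (s * p) / 2)) ≤ p := by
    rw [← Real.le_log_iff_exp_le hp]
    rw [one_div, Real.log_inv] at hsp
    have := exp_three_ge
    nlinarith [mul_pos hs hp]
  have hd := h.degree'
  calc n * (3 * Real.exp (-(Real.exp 3 * (s * p) / 2))) ≤ n * (3 * p) := by gcongr
    _ ≤ s := by nlinarith [mul_pos hn hp]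

lemma mul_overlap_le (h : Regime n s k p δ) :
    64 * Real.log (1 / p) * (k.factorial * overlap p s k) ≤ s ^ (k - 1) * p ^ k.choose 2 * δ := by
  have hs : (0 : ℝ) < s := by exact_mod_cast h.s_pos
  have hp := h.p_pos
  have hδ := h.δ_pos
  have hL1 := h.one_le_log
  have hcl := h.cliques
  have hov := h.overlaps
  have hov' := h.overlaps'
  set L := Real.log (1 / p) with hL
  obtain ⟨i, hi⟩ : ∃ i, k = i + 2 := ⟨k - 2, by have := h.two_le; omega⟩
  have hk : (0 : ℝ) < k := by exact_mod_cast (by omega : 0 < k)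
  have hk5 : 64 * ((k : ℝ) ^ 5 * L) ≤ s * p * δ := by
    rcases Nat.lt_or_ge k 3 with hk3 | hk3
    · have hk2 : k = 2 := by omega
      subst hk2
      refine le_trans ?_ hov
      push_cast
      nlinarith
    · refine le_trans ?_ (hov' hk3)
      have : 0 ≤ (k : ℝ) ^ 5 * L := by positivity
      nlinarith
  have hone : (k : ℝ) ^ 4 / (s * p) ≤ δ / (64 * k * L) := by
    rw [div_le_div_iff₀ (by positivity) (by positivity)]
    calc (k : ℝ) ^ 4 * (64 * k * L) = 64 * (k ^ 5 * L) := by ring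
      _ ≤ s * p * δ := hk5
      _ = _ := by ring
  have htwo : (k : ℝ) ^ (2 * k) / (k.factorial * s ^ (k - 1) * p ^ k.choose 2) ≤
      δ / (64 * k * L) := by
    rw [div_le_div_iff₀ (by positivity) (by positivity)]
    have hkk : (k : ℝ) ^ (2 * k) ≤ 8 ^ k * (k.factorial : ℝ) ^ 2 := by
      have h1 := pow_le_exp_mul_factorial k
      have h2 : Real.exp k ^ 2 ≤ 8 ^ k := by
        rw [← Real.exp_nat_mul, Nat.cast_ofNat, mul_comm, Real.exp_nat_mul]
        gcongr
        exact exp_two_lt.le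
      calc (k : ℝ) ^ (2 * k) = (k ^ k) ^ 2 := by rw [← pow_mul, mul_comm]
        _ ≤ (Real.exp k * k.factorial) ^ 2 := by gcongr
        _ = Real.exp k ^ 2 * (k.factorial : ℝ) ^ 2 := mul_pow _ _ _
        _ ≤ _ := by gcongr
    have hconst : (64 : ℝ) * 8 ^ k ≤ (10 ^ 4) ^ (k - 1) := by
      rw [hi, show i + 2 - 1 = i + 1 by omega]
      calc (64 : ℝ) * 8 ^ (i + 2) = 8 ^ i * 4096 := by ring
        _ ≤ (10 ^ 4) ^ i * 10 ^ 4 := by gcongr <;> norm_num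
        _ = _ := by ring
    calc (k : ℝ) ^ (2 * k) * (64 * k * L) ≤ 8 ^ k * (k.factorial : ℝ) ^ 2 * (64 * k * L) := by
          gcongr
      _ = (64 * 8 ^ k) * (k.factorial * (k.factorial * k * L)) := by ring
      _ ≤ (10 ^ 4) ^ (k - 1) * (k.factorial * (k.factorial * k * L)) := by gcongr
      _ = k.factorial * ((10 ^ 4) ^ (k - 1) * (k.factorial * k * L)) := by ring
      _ ≤ k.factorial * (s ^ (k - 1) * p ^ k.choose 2 * δ) := by gcongr
      _ = _ := by ring
  have hmain := overlap_mul_le hp h.p_le h.s_pos hone htwo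
  calc 64 * L * (k.factorial * overlap p s k)
      ≤ 64 * L * (s ^ (k - 1) * p ^ k.choose 2 * (k * (δ / (64 * k * L)))) := by gcongr
    _ = _ := by field_simp

lemma bexp_covered_le (h : Regime n s k p δ) (hδ : δ ≤ (1 - p ^ k) ^ n) {V : Type*}
    [DecidableEq V] [Fintype V] (hV : Fintype.card V = n) {S : Finset V} (hS : #S = s) :
    bexp p (pairs (univ : Finset V))
      (fun E => if Covered E k (Real.exp 2 * (n * p)) S then 1 else 0) ≤
      2 * Real.exp (-(2 * (s * ent n s))) := by
  have hs : (0 : ℝ) < s := by exact_mod_cast h.s_pos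
  have hn : (0 : ℝ) < n := by exact_mod_cast h.n_pos
  have hp := h.p_pos
  have hp1 : p ≤ 1 := h.p_le.trans (by norm_num)
  have hδ0 := h.δ_pos
  have he1 := h.one_le_ent
  have hch := h.choose_pos
  have hlam := h.rate_nonneg
  obtain ⟨i, hi⟩ : ∃ i, k = i + 1 := ⟨k - 1, by have := h.two_le; omega⟩
  set e := ent n s with he
  set lam := rate n s k δ with hlamdef
  set ε := 3 * Real.exp (-(Real.exp 3 * (s * p) / 2)) with hε
  set t := (s.choose k : ℝ) * δ / 2 with ht
  have ht0 : 0 < t := by positivity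
  set μ := t * p ^ k.choose 2 with hμ
  have hμ0 : 0 < μ := by positivity
  have hμle : s * (s ^ (k - 1) * p ^ k.choose 2 * δ) / (4 * k.factorial) ≤ μ := by
    have hsk : (s : ℝ) ^ k = s ^ (k - 1) * s := by
      rw [← pow_succ]; congr 1; omega
    have hc := h.le_choose
    calc _ = (s : ℝ) ^ k / (2 * k.factorial) * δ / 2 * p ^ k.choose 2 := by
          rw [hsk]; field_simp; norm_num
      _ ≤ _ := by rw [hμ, ht]; gcongr
  have hq1 : 4 * (s * e) / μ ≤ 1 := by
    rw [div_le_one hμ0]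
    refine le_trans ?_ hμle
    have hcl := h.cliques
    have hL := h.ent_le_log
    rw [← he] at hL
    set L := Real.log (1 / p)
    have hk : (1 : ℝ) ≤ k := by exact_mod_cast (by omega : 1 ≤ k)
    have h16 : (16 : ℝ) ≤ (10 ^ 4) ^ (k - 1) := by
      have h1 : (10 ^ 4 : ℝ) ≤ (10 ^ 4) ^ (k - 1) :=
        le_self_pow₀ (by norm_num) (by have := h.two_le; omega)
      linarith
    rw [le_div_iff₀ (by positivity)]
    calc 4 * (s * e) * (4 * k.factorial) = s * (16 * (k.factorial * 1 * e)) := by ring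
      _ ≤ s * ((10 ^ 4) ^ (k - 1) * (k.factorial * k * L)) := by gcongr
      _ ≤ _ := by gcongr
  have hq : 4 * (s * e) / μ * overlap p s k ≤ 1 / 2 := by
    have hov := h.mul_overlap_le
    have hL := h.ent_le_log
    rw [← he] at hL
    set L := Real.log (1 / p)
    have hov0 : 0 ≤ overlap p s k := sum_nonneg fun j _ => by positivity
    rw [div_mul_eq_mul_div, div_le_iff₀ hμ0]
    have h2 : 64 * e * (k.factorial * overlap p s k) ≤ s ^ (k - 1) * p ^ k.choose 2 * δ := by
      refine le_trans ?_ hov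
      gcongr
    rw [div_le_iff₀ (by positivity)] at hμle
    have h3 := mul_le_mul_of_nonneg_left h2 hs.le
    have hf : (0 : ℝ) < k.factorial := by positivity
    have h4 : (4 * (s * e) * overlap p s k) * (16 * k.factorial) ≤
        (1 / 2 * μ) * (16 * k.factorial) := by
      calc _ = s * (64 * e * (k.factorial * overlap p s k)) := by ring
        _ ≤ μ * (4 * k.factorial) := h3.trans hμle
        _ ≤ _ := by nlinarith [mul_pos hμ0 hf]
    exact le_of_mul_le_mul_right h4 (by positivity)
  have hstep : ∀ U' ⊆ powersetCard k S, ∀ θ, 0 ≤ θ → θ ≤ lam →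
      bexp p S (fun N => if (#N : ℝ) ≤ Real.exp 2 * (n * p) then
        Real.exp (-(θ * #{K ∈ U' | ¬ K ⊆ N})) else 0) ≤
        Real.exp (-(θ * (1 - p ^ k) * #U') + (s * (p * (lam * lip s k p) ^ 2) + ε)) := by
    intro U' hU' θ hθ hθl
    have hhigh := h.sum_high_degree_le
    have hlip1 := h.rate_mul_lip_le_one
    subst hS
    rw [← hlamdef] at hhigh hlip1
    rw [hi] at hU' hhigh ⊢
    exact bexp_exp_neg_card_filter_not_subset_le hp.le hp1 hU' hθ hθl (by rw [← hi]; exact hlip1)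
      (by rw [lip, Nat.add_sub_cancel]) (by positivity) hhigh
  have hmain := CliqueChromatic.bexp_covered_le hp.le hp1 (t := t) (q := 4 * (s * e) / μ) hlam hstep
    (by positivity) hq1 (by rw [hS]; exact hq)
  refine hmain.trans ?_
  have hq2 : 4 * (s * e) / μ / 2 * (t * p ^ k.choose 2) = 2 * (s * e) := by
    rw [← hμ]; field_simp; norm_num
  rw [hq2, hS, two_mul (Real.exp _)]
  refine add_le_add (Real.exp_le_exp.2 ?_) le_rfl
  have hcard : (#Sᶜ : ℝ) ≤ n := by
    rw [← hV]; exact_mod_cast card_le_univ _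
  have hpk1 : p ^ k ≤ 1 := pow_le_one₀ hp.le hp1
  have hpk0 : 0 ≤ p ^ k := by positivity
  have hδle : δ ≤ (1 - p ^ k) ^ #Sᶜ := by
    refine hδ.trans (pow_le_pow_of_le_one (by linarith) (by linarith) ?_)
    rw [← hV]; exact card_le_univ _
  have hlamt : lam * (s.choose k * δ) = 8 * (s * e) := by
    rw [hlamdef, rate, ← he]; field_simp
  have h1 : 8 * (s * e) ≤ lam * (1 - p ^ k) ^ #Sᶜ * s.choose k := by
    rw [← hlamt, mul_assoc, mul_comm _ δ]
    gcongr
  have h2 : lam * t = 4 * (s * e) := by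
    have : lam * t = lam * (s.choose k * δ) / 2 := by rw [ht]; ring
    rw [this, hlamt]; ring
  have h3 : (#Sᶜ : ℝ) * (s * (p * (lam * lip s k p) ^ 2) + ε) ≤ 2 * (s * e) := by
    have hA := h.rate_mul_lip_sq_le
    have hB := h.n_mul_high_degree_le
    rw [← hlamdef, ← he] at hA
    rw [← hε] at hB
    calc (#Sᶜ : ℝ) * (s * (p * (lam * lip s k p) ^ 2) + ε)
        ≤ n * (s * (p * (lam * lip s k p) ^ 2) + ε) := by gcongr
      _ = s * (n * p * (lam * lip s k p) ^ 2) + n * ε := by ring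
      _ ≤ s * e + s := by gcongr
      _ ≤ _ := by nlinarith
  linarith

/-- The union bound over all sets of `s` vertices. -/
lemma binomialRandom_real_le {p : unitInterval} (h : Regime n s k p δ)
    (hδ : δ ≤ (1 - (p : ℝ) ^ k) ^ n) :
    (SimpleGraph.binomialRandom (Fin n) p).real {G | cliqueChromaticNumber G * (s - 1) < n} ≤
      (n + 2) * Real.exp (-(n * p)) := by
  have hn : (0 : ℝ) < n := by exact_mod_cast h.n_pos
  have hs : (0 : ℝ) < s := by exact_mod_cast h.s_pos
  have hp := h.p_pos
  have he1 := h.one_le_ent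
  have hb := binomialRandom_real_chromatic_lt_le (V := Fin n) p (s := s) h.two_le
    (M := Real.exp 2 * (n * p)) (by rw [Fintype.card_fin])
    (fun S hS => h.bexp_covered_le hδ (Fintype.card_fin n) (mem_powersetCard.1 hS).2)
  rw [Fintype.card_fin] at hb
  refine hb.trans ?_
  have h1 : Real.exp (-(Real.exp 2 * (n * p))) ≤ Real.exp (-(n * p)) := by
    refine Real.exp_le_exp.2 (neg_le_neg ?_)
    exact le_mul_of_one_le_left (by positivity) (Real.one_le_exp (by norm_num))
  have h2 : (n.choose s : ℝ) * (2 * Real.exp (-(2 * (s * ent n s)))) ≤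
      2 * Real.exp (-(n * p)) := by
    calc (n.choose s : ℝ) * (2 * Real.exp (-(2 * (s * ent n s))))
        ≤ Real.exp (s * ent n s) * (2 * Real.exp (-(2 * (s * ent n s)))) := by
          gcongr
          exact choose_le_exp h.s_pos h.n_pos
      _ = 2 * Real.exp (-(s * ent n s)) := by
          rw [mul_left_comm, ← Real.exp_add]; ring_nf
      _ ≤ _ := by
          refine mul_le_mul_of_nonneg_left (Real.exp_le_exp.2 (neg_le_neg ?_)) (by norm_num)
          have h3 := h.degree'
          have h4 : (s : ℝ) ≤ s * ent n s := le_mul_of_one_le_right hs.le he1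
          have h5 : 0 < n * (p : ℝ) := mul_pos hn hp
          linarith
  calc _ ≤ n * Real.exp (-(n * p)) + 2 * Real.exp (-(n * p)) := by gcongr
    _ = _ := by ring

end Regime

section Parameters

lemma pow_rpow_inv_natCast_mul {x : ℝ} (hx : 0 ≤ x) (a : ℝ) {m : ℕ} (hm : m ≠ 0) :
    (x ^ (a / m)) ^ m = x ^ a := by
  rw [← Real.rpow_natCast, ← Real.rpow_mul hx, div_mul_cancel₀ _ (by exact_mod_cast hm)]

/-- The assumed upper bound on the edge probability, without roots. -/
lemma exposure_of_le {n k : ℕ} {p : ℝ} (hn : 1 ≤ n) (hk : 2 ≤ k) (hp : 0 < p) (hp1 : p ≤ 1)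
    (h : p ≤ (6 * 10 ^ 4)⁻¹ * ((k : ℝ) ^ 2 * Real.log (1 / p) * n * p) ^
      (-(1 / (2 * ((k : ℝ) - 1)))) * (1 - p ^ k) ^ ((n : ℝ) / ((k : ℝ) - 1))) :
    p < 1 ∧ (6 * 10 ^ 4) ^ (2 * (k - 1)) * (k ^ 2 * Real.log (1 / p) * n * p) *
      p ^ (2 * (k - 1)) ≤ ((1 - p ^ k) ^ n) ^ 2 := by
  obtain ⟨i, rfl⟩ : ∃ i, k = i + 1 := ⟨k - 1, by omega⟩
  have hi : i ≠ 0 := by omega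
  have hi' : (i : ℝ) ≠ 0 := by exact_mod_cast hi
  have hn' : (0 : ℝ) < n := by exact_mod_cast hn
  simp only [Nat.cast_add, Nat.cast_one, add_sub_cancel_right, Nat.add_sub_cancel] at h ⊢
  have hlt : p < 1 := by
    refine lt_of_le_of_ne hp1 fun h1 => ?_
    subst h1
    norm_num [Real.zero_rpow, hi', hn'.ne'] at h
  refine ⟨hlt, ?_⟩
  have hL : 0 < Real.log (1 / p) := Real.log_pos (by rw [lt_div_iff₀ hp]; linarith)
  set X := ((i : ℝ) + 1) ^ 2 * Real.log (1 / p) * n * p with hX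
  have hX0 : 0 < X := by positivity
  have hq : 0 ≤ 1 - p ^ (i + 1) := sub_nonneg.2 (pow_le_one₀ hp.le hp1)
  have h2 := pow_le_pow_left₀ hp.le h (2 * i)
  have e1 : (X ^ (-(1 / (2 * (i : ℝ))))) ^ (2 * i) = X⁻¹ := by
    have : -(1 / (2 * (i : ℝ))) = -1 / ((2 * i : ℕ) : ℝ) := by push_cast; ring
    rw [this, pow_rpow_inv_natCast_mul hX0.le _ (by omega), Real.rpow_neg_one]
  have e2 : ((1 - p ^ (i + 1)) ^ ((n : ℝ) / i)) ^ (2 * i) = ((1 - p ^ (i + 1)) ^ n) ^ 2 := by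
    rw [mul_comm, pow_mul, pow_rpow_inv_natCast_mul hq _ hi, Real.rpow_natCast]
  rw [mul_pow, mul_pow, e1, e2, inv_pow] at h2
  calc _ ≤ (6 * 10 ^ 4) ^ (2 * i) * X * (((6 * 10 ^ 4) ^ (2 * i))⁻¹ * X⁻¹ *
        ((1 - p ^ (i + 1)) ^ n) ^ 2) := by gcongr
    _ = _ := by field_simp

lemma le_third_of_exposure {n k : ℕ} {p : ℝ} (hn : 1 ≤ n) (hk : 2 ≤ k) (hp : 0 < p) (hp1 : p < 1)
    (h : (6 * 10 ^ 4) ^ (2 * (k - 1)) * (k ^ 2 * Real.log (1 / p) * n * p) *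
      p ^ (2 * (k - 1)) ≤ ((1 - p ^ k) ^ n) ^ 2) : p ≤ 1 / 3 := by
  have hL : 0 < Real.log (1 / p) := Real.log_pos (by rw [lt_div_iff₀ hp]; linarith)
  have hk0 : (1 : ℝ) ≤ k := by exact_mod_cast (by omega : 1 ≤ k)
  have hn' : (1 : ℝ) ≤ n := by exact_mod_cast hn
  have hpk : p ^ k ≤ 1 := pow_le_one₀ hp.le hp1.le
  have hpk0 : 0 < p ^ k := by positivity
  have h1 : ((1 - p ^ k) ^ n) ^ 2 ≤ 1 - p ^ k := by
    rw [← pow_mul]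
    exact pow_le_of_le_one (by linarith) (by linarith) (by omega)
  have h2 : 1 - p ^ k ≤ k * (1 - p) := by
    have := one_add_mul_le_pow (a := p - 1) (by linarith) k
    rw [add_sub_cancel] at this
    linarith
  have h3 : 1 - p ≤ Real.log (1 / p) := by
    have := Real.log_le_sub_one_of_pos hp
    rw [one_div, Real.log_inv]; linarith
  set L := Real.log (1 / p)
  by_contra hcon
  push Not at hcon
  have h4 : (1 : ℝ) ≤ (6 * 10 ^ 4 * p) ^ (2 * (k - 1) - 1) := one_le_pow₀ (by linarith)
  have h5 : (2 : ℝ) * 10 ^ 4 ≤ (6 * 10 ^ 4 * p) ^ (2 * (k - 1)) := by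
    have : (6 * 10 ^ 4 * p) ^ (2 * (k - 1)) =
        (6 * 10 ^ 4 * p) * (6 * 10 ^ 4 * p) ^ (2 * (k - 1) - 1) := by
      rw [← pow_succ']; congr 1; omega
    rw [this]
    nlinarith
  have h6 : (2 * 10 ^ 4) * (1 * (k * L) * 1 * (1 / 3)) ≤ k * L := by
    calc (2 * 10 ^ 4) * (1 * (k * L) * 1 * (1 / 3))
        ≤ (6 * 10 ^ 4 * p) ^ (2 * (k - 1)) * (k * (k * L) * n * p) := by gcongr
      _ = (6 * 10 ^ 4) ^ (2 * (k - 1)) * (k ^ 2 * L * n * p) * p ^ (2 * (k - 1)) := by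
          rw [mul_pow]; ring
      _ ≤ k * L := by
          refine h.trans (h1.trans (h2.trans ?_))
          gcongr
  have : 0 < k * L := by positivity
  linarith

/-- The lower bound for the clique chromatic number. -/
noncomputable def lowerBound (n k : ℕ) (p : ℝ) : ℝ :=
  1 / (10 ^ 4) ^ 2 * min (1 / p) (p ^ ((k : ℝ) / 2) * n /
    ((k.factorial : ℝ) * k * Real.log (1 / p)) ^ (1 / ((k : ℝ) - 1))) *
    (1 - p ^ k) ^ ((n : ℝ) / ((k : ℝ) - 1))

set_option maxHeartbeats 1000000 in
lemma exists_regime {n k : ℕ} {p : ℝ} (hn : 2 ≤ n) (hk : 2 ≤ k) (hp : 0 < p) (hp1 : p ≤ 1)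
    (hlog : Real.log (1 / p) ≤ n * p)
    (h₁ : p ≤ (6 * 10 ^ 4)⁻¹ * ((k : ℝ) ^ 2 * Real.log (1 / p) * n * p) ^
      (-(1 / (2 * ((k : ℝ) - 1)))) * (1 - p ^ k) ^ ((n : ℝ) / ((k : ℝ) - 1)))
    (h₂ : (if 3 ≤ k then (k : ℝ) ^ 5 * Real.log (1 / p) else 0) ≤
      max (n * p ^ 2) (p ^ (-(((k : ℝ) - 2) / 2))) *
        (1 - p ^ k) ^ ((n : ℝ) * ((k : ℝ) - 2) / ((k : ℝ) - 1)))
    (hR : 1 < lowerBound n k p) :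
    ∃ s, Regime n s k p ((1 - p ^ k) ^ n) ∧
      ∀ m : ℕ, (m : ℝ) < lowerBound n k p → m * (s - 1) < n := by
  obtain ⟨hlt, hexp⟩ := exposure_of_le (by omega) hk hp hp1 h₁
  have hp3 := le_third_of_exposure (by omega) hk hp hlt hexp
  have hn' : (2 : ℝ) ≤ n := by exact_mod_cast hn
  have hL1 : 1 ≤ Real.log (1 / p) := by
    rw [Real.le_log_iff_exp_le (by positivity)]
    have h3 : 3 ≤ 1 / p := by rw [le_div_iff₀ hp]; linarith
    have := Real.exp_one_lt_d9
    linarith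
  obtain ⟨i, hi⟩ : ∃ i, k = i + 1 := ⟨k - 1, by omega⟩
  have hi0 : i ≠ 0 := by omega
  have hi0' : (i : ℝ) ≠ 0 := by exact_mod_cast hi0
  have hki : (k : ℝ) - 1 = i := by rw [hi]; push_cast; ring
  have hk2 : (2 : ℝ) ≤ k := by exact_mod_cast hk
  have hpk : p ^ k < 1 := pow_lt_one₀ hp.le hlt (by omega)
  have hpk0 : 0 < p ^ k := by positivity
  have hq0 : 0 < 1 - p ^ k := by linarith
  have hq1 : 1 - p ^ k ≤ 1 := by linarith
  set L := Real.log (1 / p) with hL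
  set δ := (1 - p ^ k) ^ n with hδ
  have hδ0 : 0 < δ := by positivity
  have hδ1 : δ ≤ 1 := pow_le_one₀ hq0.le hq1
  set η := (1 - p ^ k) ^ ((n : ℝ) / ((k : ℝ) - 1)) with hη
  have hη0 : 0 < η := Real.rpow_pos_of_pos hq0 _
  have hη1 : η ≤ 1 := Real.rpow_le_one hq0.le hq1 (by rw [hki]; positivity)
  have hηδ : η ^ i = δ := by
    rw [hη, hki, pow_rpow_inv_natCast_mul hq0.le _ hi0, Real.rpow_natCast]
  set Q := ((k.factorial : ℝ) * k * L) ^ (1 / ((k : ℝ) - 1)) with hQ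
  have hfac : (1 : ℝ) ≤ (k.factorial : ℝ) * k * L := by
    have h1 : (1 : ℝ) ≤ k.factorial := by exact_mod_cast Nat.one_le_iff_ne_zero.2 k.factorial_ne_zero
    have h2 : (1 : ℝ) ≤ (k.factorial : ℝ) * k := by nlinarith
    nlinarith
  have hQ1 : 1 ≤ Q := Real.one_le_rpow hfac (by rw [hki]; positivity)
  have hQi : Q ^ i = (k.factorial : ℝ) * k * L := by
    rw [hQ, hki, pow_rpow_inv_natCast_mul (by linarith) _ hi0, Real.rpow_one]
  set r := p ^ ((k : ℝ) / 2) with hr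
  have hr0 : 0 < r := Real.rpow_pos_of_pos hp _
  have hri : r ^ i = p ^ k.choose 2 := by
    rw [hr, ← Real.rpow_natCast, ← Real.rpow_mul hp.le, ← Real.rpow_natCast, Nat.cast_choose_two,
      hki]
    congr 1; ring
  set m := min (1 / p) (r * n / Q) with hm
  have hm0 : 0 < m := lt_min (by positivity) (by positivity)
  have hRm : lowerBound n k p = 1 / (10 ^ 4) ^ 2 * m * η := rfl
  set s := ⌈(n : ℝ) * 10 ^ 4 / (m * η)⌉₊ with hs
  have hsle : (n : ℝ) * 10 ^ 4 / (m * η) ≤ s := Nat.le_ceil _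
  have hslt : (s : ℝ) < n * 10 ^ 4 / (m * η) + 1 := Nat.ceil_lt_add_one (by positivity)
  have hs0 : (0 : ℝ) < s := lt_of_lt_of_le (by positivity) hsle
  rw [div_le_iff₀ (by positivity)] at hsle
  have hsη1 : 10 ^ 4 * (n * p) ≤ s * η := by
    have h1 : m ≤ 1 / p := min_le_left _ _
    have h2 : (n : ℝ) * 10 ^ 4 ≤ s * (1 / p * η) := hsle.trans (by gcongr)
    calc 10 ^ 4 * (n * p) = n * 10 ^ 4 * p := by ring
      _ ≤ s * (1 / p * η) * p := by gcongr
      _ = s * η := by field_simp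
  have hsη2 : 10 ^ 4 * Q ≤ s * r * η := by
    have h1 : m ≤ r * n / Q := min_le_right _ _
    have h2 : (n : ℝ) * 10 ^ 4 ≤ s * (r * n / Q * η) := hsle.trans (by gcongr)
    have h3 : (n : ℝ) * (10 ^ 4 * Q) ≤ n * (s * r * η) := by
      calc (n : ℝ) * (10 ^ 4 * Q) = n * 10 ^ 4 * Q := by ring
        _ ≤ s * (r * n / Q * η) * Q := by gcongr
        _ = _ := by field_simp
    exact le_of_mul_le_mul_left h3 (by linarith)
  have hcliques : (10 ^ 4) ^ (k - 1) * (k.factorial * k * L) ≤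
      s ^ (k - 1) * p ^ k.choose 2 * δ := by
    rw [show k - 1 = i by omega, ← hri, ← hηδ, ← hQi, ← mul_pow, ← mul_pow, ← mul_pow]
    gcongr
  have hoverlaps' : 3 ≤ k → 10 ^ 4 * (k ^ 5 * L) ≤ s * p * δ := by
    intro hk3
    rw [if_pos hk3] at h₂
    have hδη : η * (1 - p ^ k) ^ ((n : ℝ) * ((k : ℝ) - 2) / ((k : ℝ) - 1)) = δ := by
      have e1 : (n : ℝ) / ((k : ℝ) - 1) + (n : ℝ) * ((k : ℝ) - 2) / ((k : ℝ) - 1) = n := by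
        rw [← add_div, div_eq_iff (by rw [hki]; exact hi0')]
        ring
      rw [hη, ← Real.rpow_add hq0, e1, Real.rpow_natCast]
    have hmax : 10 ^ 4 * max (n * p ^ 2) (p ^ (-(((k : ℝ) - 2) / 2))) ≤ s * p * η := by
      rw [mul_max_of_nonneg _ _ (by norm_num)]
      refine max_le ?_ ?_
      · calc 10 ^ 4 * (n * p ^ 2) = 10 ^ 4 * (n * p) * p := by ring
          _ ≤ s * η * p := by gcongr
          _ = _ := by ring
      · have e1 : p = r * p ^ (-(((k : ℝ) - 2) / 2)) := by
          rw [hr, ← Real.rpow_add hp]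
          conv_lhs => rw [← Real.rpow_one p]
          congr 1; ring
        have hy : 0 < p ^ (-(((k : ℝ) - 2) / 2)) := Real.rpow_pos_of_pos hp _
        set y := p ^ (-(((k : ℝ) - 2) / 2))
        calc 10 ^ 4 * y ≤ 10 ^ 4 * Q * y := by
              gcongr
              linarith
          _ ≤ s * r * η * y := by gcongr
          _ = s * (r * y) * η := by ring
          _ = s * p * η := by rw [← e1]
    calc 10 ^ 4 * (k ^ 5 * L) ≤ 10 ^ 4 * (max (n * p ^ 2) (p ^ (-(((k : ℝ) - 2) / 2))) *
          (1 - p ^ k) ^ ((n : ℝ) * ((k : ℝ) - 2) / ((k : ℝ) - 1))) := by gcongr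
      _ = 10 ^ 4 * max (n * p ^ 2) (p ^ (-(((k : ℝ) - 2) / 2))) *
          (1 - p ^ k) ^ ((n : ℝ) * ((k : ℝ) - 2) / ((k : ℝ) - 1)) := by ring
      _ ≤ s * p * η * (1 - p ^ k) ^ ((n : ℝ) * ((k : ℝ) - 2) / ((k : ℝ) - 1)) := by gcongr
      _ = s * p * δ := by rw [mul_assoc, hδη]
  have hsn : (n : ℝ) * 10 ^ 4 / (m * η) < n / 10 ^ 4 := by
    rw [hRm] at hR
    rw [div_lt_div_iff₀ (by positivity) (by norm_num)]
    have h1 : (10 ^ 4 : ℝ) ^ 2 < m * η := by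
      have : 1 / (10 ^ 4 : ℝ) ^ 2 * m * η = m * η / (10 ^ 4) ^ 2 := by ring
      rwa [this, one_lt_div (by norm_num)] at hR
    nlinarith
  refine ⟨s, ⟨hp, by linarith, hk, by exact_mod_cast hs0, ?_, hδ0, hδ1, hL1, hlog, ?_,
    hsη1.trans (mul_le_of_le_one_right hs0.le hη1), hcliques, hexp, ?_, hoverlaps'⟩, ?_⟩
  · have : (s : ℝ) ≤ n := by linarith
    exact_mod_cast this
  · rw [show k - 1 = i by omega, ← hηδ, ← mul_pow]
    gcongr
  · rcases Nat.lt_or_ge k 3 with hk3 | hk3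
    · have hk' : k = 2 := by omega
      rw [hk', show 2 - 1 = 1 from rfl, pow_one, pow_one, Nat.factorial_two, Nat.choose_self,
        pow_one] at hcliques
      rw [hk']
      refine le_trans (le_of_eq ?_) hcliques
      push_cast
      ring
    · refine le_trans ?_ (hoverlaps' hk3)
      gcongr
      · linarith
      · norm_num
  · intro c hc
    have h1 : ((s - 1 : ℕ) : ℝ) < n * 10 ^ 4 / (m * η) := by
      rw [Nat.cast_sub (by exact_mod_cast hs0)]
      push_cast
      linarith
    have h2 : (c : ℝ) * ((s - 1 : ℕ) : ℝ) < n := by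
      calc (c : ℝ) * ((s - 1 : ℕ) : ℝ) ≤ lowerBound n k p * (n * 10 ^ 4 / (m * η)) := by gcongr
        _ = n / 10 ^ 4 := by rw [hRm]; field_simp
        _ < n := by linarith
    exact_mod_cast h2

end Parameters

open Filter Topology

lemma one_le_cliqueChromaticNumber {n : ℕ} (hn : 0 < n) (G : SimpleGraph (Fin n)) :
    1 ≤ cliqueChromaticNumber G := by
  obtain ⟨c, -⟩ := cliqueChromaticNumber_spec G
  exact Nat.one_le_iff_ne_zero.2 fun h => (h ▸ c ⟨0, hn⟩ : Fin 0).elim0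

lemma le_binomialRandom_lowerBound {n k : ℕ} {p : unitInterval} (hn : 2 ≤ n) (hk : 2 ≤ k)
    (hp : 0 < (p : ℝ)) (hlog : Real.log (1 / p) ≤ n * p)
    (h₁ : (p : ℝ) ≤ (6 * 10 ^ 4)⁻¹ * ((k : ℝ) ^ 2 * Real.log (1 / p) * n * p) ^
      (-(1 / (2 * ((k : ℝ) - 1)))) * (1 - (p : ℝ) ^ k) ^ ((n : ℝ) / ((k : ℝ) - 1)))
    (h₂ : (if 3 ≤ k then (k : ℝ) ^ 5 * Real.log (1 / p) else 0) ≤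
      max (n * (p : ℝ) ^ 2) ((p : ℝ) ^ (-(((k : ℝ) - 2) / 2))) *
        (1 - (p : ℝ) ^ k) ^ ((n : ℝ) * ((k : ℝ) - 2) / ((k : ℝ) - 1))) :
    1 - ENNReal.ofReal ((n + 2) * Real.exp (-(n * p))) ≤
      SimpleGraph.binomialRandom (Fin n) p
        {G | lowerBound n k p ≤ (cliqueChromaticNumber G : ℝ)} := by
  set A := {G : SimpleGraph (Fin n) | lowerBound n k p ≤ (cliqueChromaticNumber G : ℝ)} with hA
  rcases le_or_gt (lowerBound n k p) 1 with hR | hR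
  · have huniv : A = Set.univ := Set.eq_univ_of_forall fun G => hR.trans (by
      exact_mod_cast one_le_cliqueChromaticNumber (by omega) G)
    rw [huniv, MeasureTheory.measure_univ]
    exact tsub_le_self
  obtain ⟨s, hreg, hs⟩ := exists_regime hn hk hp p.2.2 hlog h₁ h₂ hR
  have hb := hreg.binomialRandom_real_le le_rfl
  have hcompl : SimpleGraph.binomialRandom (Fin n) p Aᶜ ≤
      ENNReal.ofReal ((n + 2) * Real.exp (-(n * p))) := by
    refine (MeasureTheory.measure_mono fun G hG => ?_).trans
      (((ENNReal.ofReal_toReal (MeasureTheory.measure_ne_top _ _)).symm).trans_le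
        (ENNReal.ofReal_le_ofReal hb))
    exact hs _ (not_le.1 hG)
  rw [tsub_le_iff_right, ← MeasureTheory.measure_univ (μ := SimpleGraph.binomialRandom (Fin n) p),
    ← Set.union_compl_self A]
  exact (MeasureTheory.measure_union_le _ _).trans (add_le_add_right hcompl _)

lemma tendsto_add_two_mul_exp_neg_rpow {τ : ℝ} (hτ : 0 < τ) :
    Tendsto (fun n : ℕ => ((n : ℝ) + 2) * Real.exp (-(n : ℝ) ^ τ)) atTop (𝓝 0) := by
  have hpow : Tendsto (fun n : ℕ => (n : ℝ) ^ τ) atTop atTop :=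
    (tendsto_rpow_atTop hτ).comp tendsto_natCast_atTop_atTop
  have h1 := (tendsto_rpow_mul_exp_neg_mul_atTop_nhds_zero (1 / τ) 1 one_pos).comp hpow
  have h2 : Tendsto (fun n : ℕ => 2 * Real.exp (-(n : ℝ) ^ τ)) atTop (𝓝 0) := by
    simpa using ((Real.tendsto_exp_neg_atTop_nhds_zero.comp hpow).const_mul 2)
  have h3 := h1.add h2
  rw [add_zero] at h3
  refine h3.congr fun n => ?_
  have : ((n : ℝ) ^ τ) ^ (1 / τ) = n := by
    rw [← Real.rpow_mul (Nat.cast_nonneg n), mul_one_div_cancel hτ.ne', Real.rpow_one]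
  simp only [Function.comp_apply, this]
  ring_nf

end CliqueChromatic

theorem theorem3 :
    ∃ C : ℝ, Real.exp 1 ≤ C ∧
      ∀ τ : ℝ, 0 < τ → τ < 1 →
      ∀ (k : ℕ → ℕ) (p : ℕ → unitInterval),
        (∀ᶠ n : ℕ in Filter.atTop,
          2 ≤ k n ∧
          (n : ℝ) ^ (-1 + τ) ≤ (p n : ℝ) ∧
          (p n : ℝ) ≤ (6 * C)⁻¹
              * ((k n : ℝ) ^ 2 * Real.log (1 / (p n : ℝ)) * (n : ℝ) * (p n : ℝ))
                  ^ (-(1 / (2 * ((k n : ℝ) - 1))))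
              * (1 - (p n : ℝ) ^ (k n)) ^ ((n : ℝ) / ((k n : ℝ) - 1)) ∧
          (if 3 ≤ k n then (k n : ℝ) ^ 5 * Real.log (1 / (p n : ℝ)) else 0) ≤
            max ((n : ℝ) * (p n : ℝ) ^ 2) ((p n : ℝ) ^ (-(((k n : ℝ) - 2) / 2)))
              * (1 - (p n : ℝ) ^ (k n)) ^ ((n : ℝ) * ((k n : ℝ) - 2) / ((k n : ℝ) - 1))) →
        Filter.Tendsto
          (fun n : ℕ => SimpleGraph.binomialRandom (Fin n) (p n)
            {G : SimpleGraph (Fin n) |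
              1 / C ^ 2
                * min (1 / (p n : ℝ))
                    ((p n : ℝ) ^ ((k n : ℝ) / 2) * (n : ℝ)
                      / (((k n).factorial : ℝ) * (k n : ℝ) * Real.log (1 / (p n : ℝ)))
                          ^ (1 / ((k n : ℝ) - 1)))
                * (1 - (p n : ℝ) ^ (k n)) ^ ((n : ℝ) / ((k n : ℝ) - 1))
              ≤ (CliqueChromatic.cliqueChromaticNumber G : ℝ)})
          Filter.atTop (nhds 1) := by
  refine ⟨10 ^ 4, by have := Real.exp_one_lt_d9; linarith, fun τ hτ _ k p h => ?_⟩
  have hlim : Filter.Tendsto (fun n : ℕ => 1 - ENNReal.ofReal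
      (((n : ℝ) + 2) * Real.exp (-(n : ℝ) ^ τ))) Filter.atTop (nhds 1) := by
    have h1 := ENNReal.tendsto_ofReal (CliqueChromatic.tendsto_add_two_mul_exp_neg_rpow hτ)
    have h2 := ENNReal.Tendsto.sub (tendsto_const_nhds (x := (1 : ENNReal))) h1
      (Or.inl ENNReal.one_ne_top)
    simpa using h2
  have hlog : ∀ᶠ n : ℕ in Filter.atTop, Real.log n ≤ (n : ℝ) ^ τ := by
    have h1 := (isLittleO_log_rpow_atTop hτ).bound one_pos
    filter_upwards [tendsto_natCast_atTop_atTop.eventually h1] with n hn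
    rw [one_mul, Real.norm_eq_abs, Real.norm_of_nonneg (by positivity : 0 ≤ (n : ℝ) ^ τ)] at hn
    exact (le_abs_self _).trans hn
  refine tendsto_of_tendsto_of_tendsto_of_le_of_le' hlim tendsto_const_nhds ?_
    (Filter.Eventually.of_forall fun n => MeasureTheory.prob_le_one)
  filter_upwards [h, hlog, Filter.eventually_ge_atTop 2] with n hn hlogn hn2
  obtain ⟨hk, hlow, h₁, h₂⟩ := hn
  have hn0 : (0 : ℝ) < n := by exact_mod_cast (by omega : 0 < n)
  have hp : (0 : ℝ) < p n := lt_of_lt_of_le (Real.rpow_pos_of_pos hn0 _) hlow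
  have hnp : (n : ℝ) ^ τ ≤ n * p n := by
    calc (n : ℝ) ^ τ = n * (n : ℝ) ^ (-1 + τ) := by
          rw [Real.rpow_add hn0, Real.rpow_neg_one, mul_inv_cancel_left₀ hn0.ne']
      _ ≤ _ := by gcongr
  have hL : Real.log (1 / (p n : ℝ)) ≤ n * p n := by
    refine le_trans (Real.log_le_log (by positivity) ?_) (hlogn.trans hnp)
    rw [div_le_iff₀ hp]
    exact (Real.one_le_rpow (by exact_mod_cast (by omega : 1 ≤ n)) hτ.le).trans hnp
  refine le_trans (tsub_le_tsub_left (ENNReal.ofReal_le_ofReal ?_) _)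
    (CliqueChromatic.le_binomialRandom_lowerBound hn2 hk hp hL h₁ h₂)
  gcongr
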